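/- Let $(\omega_n)_{n\in\mathbb Z^d}$ be independent, identically distributed real random variables on a probability space, whose common distribution has a bounded, compactly supported density $\rho\ge 0$ on $\mathbb R$. Write $|k|=|k_1|+\dots+|k_d|$ for $k\in\mathbb Z^d$, let $(e_x)_{x\in\mathbb Z^d}$ be the canonical basis of $\ell^2(\mathbb Z^d)$, and let $h=h_\omega$ be the Anderson Hamiltonian on $\ell^2(\mathbb Z^d)$, $$(hu)(n)=-\sum_{|k|=1}u(n+k)+\omega_n u(n),$$ which is almost surely a bounded self-adjoint operator. Let $G(x,y;z)=\langle e_x,(h-z)^{-1}e_y\rangle$ for $z\in\mathbb C\setminus\mathbb R$, and let $\mu_{x,y}(B)=\langle e_x,\chi_B(h)e_y\rangle$ ($B\subset\mathbb R$ Borel) be the mixed spectral measures of $h$, with total variation $|\mu_{x,y}|$. Let $I\subset\mathbb R$ be a bounded open interval, and suppose that there are $s\in(0,1)$, $C<\infty$ and $\mu>0$ such that $$\mathbb E\big(|G(x,y;E+i\varepsilon)|^s\big)\le C e^{-\mu|x-y|}\qquad\text{for all }x,y\in\mathbb Z^d,\ E\in I,\ \varepsilon>0.$$ Then: 1. (Dynamical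 localization in $I$.) There are constants $C'<\infty$ and $\mu'>0$ such that for all $x,y\in\mathbb Z^d$ $$\mathbb E\Big(\sup_{t\in\mathbb R}|\langle e_x,e^{-ith}\chi_I(h)e_y\rangle|\Big)\le C'e^{-\mu'|x-y|}.$$ 2. There are constants $C''<\infty$ and $\mu''>0$ such that for all $x,y\in\mathbb Z^d$ $$\mathbb E\big(|\mu_{x,y}|(I)\big)=\mathbb E\Big(\sup_{g:\mathbb R\to\mathbb C\ \text{Borel},\ |g|\le1}|\langle e_x,g(h)\chi_I(h)e_y\rangle|\Big)\le C''e^{-\mu''|x-y|}.$$ (All random variables under the expectations in 1 and 2 are measurable with respect to the completed probability space.) -/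

import Mathlib

open MeasureTheory ProbabilityTheory
open scoped ENNReal CompactlySupported

noncomputable section

/-! ### Spectral measures and Borel functional calculus of a bounded self-adjoint operator -/

section FunctionalCalculus

variable {H : Type*} [NormedAddCommGroup H] [InnerProductSpace ℂ H] [CompleteSpace H]

/-- The positive linear functional `f ↦ ⟨ψ, f(a) ψ⟩` on `C_c(ℝ)`, where `f(a)` is the continuous
functional calculus of the (self-adjoint) operator `a`. -/
def spectralFunctional (a : H →L[ℂ] H) (ψ : H) : C_c(ℝ, ℝ) →ₚ[ℝ] ℝ where
  toFun f := (inner ℂ ψ (cfc (fun r => f r) a ψ)).re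
  map_add' f g := by
    have h : cfc (fun r => (f + g) r) a = cfc (fun r => f r) a + cfc (fun r => g r) a :=
      cfc_add (R := ℝ) (fun r => f r) (fun r => g r) (a := a)
        (f.continuous.continuousOn) (g.continuous.continuousOn)
    rw [h]
    simp
  map_smul' c f := by
    have h : cfc (fun r => (c • f) r) a = c • cfc (fun r => f r) a :=
      cfc_smul (R := ℝ) c (fun r => f r) (a := a) (f.continuous.continuousOn)
    rw [h]
    simp [inner_smul_right_eq_smul]
  monotone' f g hfg := by
    have h : cfc (fun r => f r) a ≤ cfc (fun r => g r) a :=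
      cfc_mono (fun r _ => hfg r) (f.continuous.continuousOn) (g.continuous.continuousOn)
    have h2 := (ContinuousLinearMap.le_def _ _).1 h
    have h3 := h2.re_inner_nonneg_right ψ
    simp only [sub_apply, inner_sub_right] at h3
    simpa using h3

/-- The spectral measure `μ_ψ` of `a` at the vector `ψ`: the Borel measure on `ℝ` with
`∫ f dμ_ψ = ⟨ψ, f(a) ψ⟩` for all `f ∈ C_c(ℝ)`. -/
def spectralMeasure (a : H →L[ℂ] H) (ψ : H) : Measure ℝ :=
  RealRMK.rieszMeasure (spectralFunctional a ψ)

theorem integral_spectralMeasure (a : H →L[ℂ] H) (ψ : H) (f : C_c(ℝ, ℝ)) :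
    ∫ r, f r ∂(spectralMeasure a ψ) = (inner ℂ ψ (cfc (fun r => f r) a ψ)).re :=
  RealRMK.integral_rieszMeasure (spectralFunctional a ψ) f

theorem spectralFunctional_le (a : H →L[ℂ] H) (ψ : H) (f : C_c(ℝ, ℝ)) (hf : ∀ r, ‖f r‖ ≤ 1) :
    spectralFunctional a ψ f ≤ ‖ψ‖ ^ 2 := by
  have h : ‖cfc (fun r => f r) a‖ ≤ 1 := norm_cfc_le zero_le_one (fun r _ => hf r)
  change (inner ℂ ψ (cfc (fun r => f r) a ψ)).re ≤ _
  calc _ ≤ ‖inner ℂ ψ (cfc (fun r => f r) a ψ)‖ := Complex.re_le_norm _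
    _ ≤ ‖ψ‖ * ‖cfc (fun r => f r) a ψ‖ := norm_inner_le_norm _ _
    _ ≤ ‖ψ‖ * (1 * ‖ψ‖) := by
        gcongr; exact ContinuousLinearMap.le_of_opNorm_le _ h _
    _ = ‖ψ‖ ^ 2 := by ring

instance (a : H →L[ℂ] H) (ψ : H) : (spectralMeasure a ψ).Regular :=
  RealRMK.regular_rieszMeasure _

theorem spectralMeasure_univ_le (a : H →L[ℂ] H) (ψ : H) :
    spectralMeasure a ψ Set.univ ≤ ENNReal.ofReal (‖ψ‖ ^ 2) := by
  rw [isOpen_univ.measure_eq_iSup_isCompact (spectralMeasure a ψ)]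
  · refine iSup_le fun K => iSup_le fun _ => iSup_le fun hK => ?_
    obtain ⟨f, hf1, hf2, hf3⟩ :=
      exists_continuousMap_one_of_isCompact_subset_isOpen hK isOpen_univ (Set.subset_univ K)
    let F : C_c(ℝ, ℝ) := ⟨f, hf2⟩
    refine (RealRMK.rieszMeasure_le_of_eq_one (spectralFunctional a ψ) (f := F)
      (fun r => (hf3.2 r).1) hK (fun r hr => hf1 hr)).trans ?_
    refine ENNReal.ofReal_le_ofReal (spectralFunctional_le a ψ F fun r => ?_)
    have h := hf3.2 r
    rw [Real.norm_eq_abs, abs_le]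
    exact ⟨by have := h.1; change -1 ≤ f r; linarith, h.2⟩

instance (a : H →L[ℂ] H) (ψ : H) : IsFiniteMeasure (spectralMeasure a ψ) :=
  ⟨(spectralMeasure_univ_le a ψ).trans_lt ENNReal.ofReal_lt_top⟩

theorem integrable_spectralMeasure (a : H →L[ℂ] H) (ψ : H) {g : ℝ → ℂ} (hg : Measurable g)
    {M : ℝ} (hM : ∀ r, ‖g r‖ ≤ M) : Integrable g (spectralMeasure a ψ) :=
  Integrable.of_bound hg.aestronglyMeasurable M (Filter.Eventually.of_forall hM)

theorem norm_integral_spectralMeasure_le (a : H →L[ℂ] H) (ψ : H) {g : ℝ → ℂ}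
    {M : ℝ} (hM0 : 0 ≤ M) (hM : ∀ r, ‖g r‖ ≤ M) :
    ‖∫ r, g r ∂(spectralMeasure a ψ)‖ ≤ M * ‖ψ‖ ^ 2 := by
  refine (norm_integral_le_of_norm_le_const (Filter.Eventually.of_forall hM)).trans ?_
  gcongr
  exact ENNReal.toReal_le_of_le_ofReal (by positivity) (spectralMeasure_univ_le a ψ)

/-- A real linear relation between spectral measures, tested on `C_c(ℝ)`, holds for all bounded
Borel functions. -/
theorem sum_integral_spectralMeasure_eq_zero_of_real (a : H →L[ℂ] H) (s : Finset H) (c : H → ℝ)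
    (h : ∀ f : C_c(ℝ, ℝ), ∑ v ∈ s, c v * ∫ r, f r ∂(spectralMeasure a v) = 0)
    {g : ℝ → ℂ} (hg : Measurable g) {M : ℝ} (hM : ∀ r, ‖g r‖ ≤ M) :
    ∑ v ∈ s, (c v : ℂ) * ∫ r, g r ∂(spectralMeasure a v) = 0 := by
  have hc : ∀ v, c v = (c v).toNNReal - (-c v).toNNReal := fun v => by
    simp only [Real.coe_toNNReal', max_zero_sub_max_neg_zero_eq_self]
  let μp : Measure ℝ := ∑ v ∈ s, (c v).toNNReal • spectralMeasure a v
  let μm : Measure ℝ := ∑ v ∈ s, (-c v).toNNReal • spectralMeasure a v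
  have hint : ∀ (d : H → NNReal) (G : ℝ → ℂ), (∀ v, Integrable G (spectralMeasure a v)) →
      ∫ r, G r ∂(∑ v ∈ s, d v • spectralMeasure a v)
        = ∑ v ∈ s, (d v : ℂ) * ∫ r, G r ∂(spectralMeasure a v) := by
    intro d G hG
    rw [integral_finsetSum_measure (fun v _ => (hG v).smul_measure_nnreal)]
    refine Finset.sum_congr rfl fun v _ => ?_
    rw [integral_smul_nnreal_measure]
    rfl
  have hintR : ∀ (d : H → NNReal) (G : ℝ → ℝ), (∀ v, Integrable G (spectralMeasure a v)) →
      ∫ r, G r ∂(∑ v ∈ s, d v • spectralMeasure a v)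
        = ∑ v ∈ s, (d v : ℝ) * ∫ r, G r ∂(spectralMeasure a v) := by
    intro d G hG
    rw [integral_finsetSum_measure (fun v _ => (hG v).smul_measure_nnreal)]
    refine Finset.sum_congr rfl fun v _ => ?_
    rw [integral_smul_nnreal_measure]
    rfl
  have hμ : μp = μm := by
    have : IsFiniteMeasure μp := by dsimp only [μp]; infer_instance
    have : IsFiniteMeasure μm := by dsimp only [μm]; infer_instance
    refine Measure.ext_of_integral_eq_on_compactlySupported fun f => ?_
    dsimp only [μp, μm]
    rw [hintR _ _ fun v => f.integrable, hintR _ _ fun v => f.integrable, ← sub_eq_zero,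
      ← Finset.sum_sub_distrib, ← h f]
    refine Finset.sum_congr rfl fun v _ => ?_
    rw [← sub_mul, ← hc v]
  have e1 := hint (fun v => (c v).toNNReal) g fun v => integrable_spectralMeasure a v hg hM
  have e2 := hint (fun v => (-c v).toNNReal) g fun v => integrable_spectralMeasure a v hg hM
  have e3 : ∫ r, g r ∂μp = ∫ r, g r ∂μm := by rw [hμ]
  dsimp only [μp, μm] at e3
  rw [e1, e2, ← sub_eq_zero, ← Finset.sum_sub_distrib] at e3
  rw [← e3]
  refine Finset.sum_congr rfl fun v _ => ?_
  rw [← sub_mul]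
  congr 1
  exact_mod_cast congrArg (fun t : ℝ => (t : ℂ)) (hc v)

/-- A linear relation between quadratic forms `v ↦ ⟨v, T v⟩` that holds for all operators `T`
holds for the forms `v ↦ ∫ g dμ_v`. -/
theorem linearCombination_integral_eq_zero (a : H →L[ℂ] H) (x : H →₀ ℂ)
    (h : ∀ T : H →L[ℂ] H, Finsupp.linearCombination ℂ (fun v => inner ℂ v (T v)) x = 0)
    {g : ℝ → ℂ} (hg : Measurable g) {M : ℝ} (hM : ∀ r, ‖g r‖ ≤ M) :
    Finsupp.linearCombination ℂ (fun v => ∫ r, g r ∂(spectralMeasure a v)) x = 0 := by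
  have hreal : ∀ (f : C_c(ℝ, ℝ)) (v : H), inner ℂ v (cfc (fun r => f r) a v)
      = ((∫ r, f r ∂(spectralMeasure a v) : ℝ) : ℂ) := by
    intro f v
    rw [integral_spectralMeasure]
    have hsa : IsSelfAdjoint (cfc (fun r => f r) a) := cfc_predicate _ _
    exact (hsa.isSymmetric.coe_re_inner_self_apply v).symm
  have hsum : ∀ f : C_c(ℝ, ℝ),
      ∑ v ∈ x.support, x v * ((∫ r, f r ∂(spectralMeasure a v) : ℝ) : ℂ) = 0 := by
    intro f
    have := h (cfc (fun r => f r) a)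
    rw [Finsupp.linearCombination_apply, Finsupp.sum] at this
    rw [← this]
    exact Finset.sum_congr rfl fun v _ => by rw [hreal, smul_eq_mul]
  have h1 := sum_integral_spectralMeasure_eq_zero_of_real a x.support (fun v => (x v).re)
    (fun f => by simpa using congrArg Complex.re (hsum f)) hg hM
  have h2 := sum_integral_spectralMeasure_eq_zero_of_real a x.support (fun v => (x v).im)
    (fun f => by simpa using congrArg Complex.im (hsum f)) hg hM
  rw [Finsupp.linearCombination_apply, Finsupp.sum]
  calc _ = ∑ v ∈ x.support, (((x v).re : ℂ) * ∫ r, g r ∂(spectralMeasure a v)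
            + Complex.I * (((x v).im : ℂ) * ∫ r, g r ∂(spectralMeasure a v))) := by
          refine Finset.sum_congr rfl fun v _ => ?_
          conv_lhs => rw [smul_eq_mul, ← Complex.re_add_im (x v)]
          ring
    _ = 0 := by rw [Finset.sum_add_distrib, ← Finset.mul_sum, h1, h2]; simp

/-- The polarization of a pair of vectors, as a formal linear combination of vectors. -/
def polarization (φ ψ : H) : H →₀ ℂ :=
  (1 / 4 : ℂ) • (Finsupp.single (φ + ψ) 1 - Finsupp.single (φ - ψ) 1
    - Finsupp.single (φ + Complex.I • ψ) Complex.I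
    + Finsupp.single (φ - Complex.I • ψ) Complex.I)

theorem linearCombination_polarization (T : H →L[ℂ] H) (φ ψ : H) :
    Finsupp.linearCombination ℂ (fun v => inner ℂ v (T v)) (polarization φ ψ)
      = inner ℂ φ (T ψ) := by
  simp only [polarization, map_smul, map_add, map_sub, Finsupp.linearCombination_single,
    inner_add_left, inner_add_right, inner_sub_left, inner_sub_right, inner_smul_left,
    inner_smul_right, smul_eq_mul, Complex.conj_I]
  ring_nf
  simp only [Complex.I_sq]
  ring

theorem linearCombination_integral_eq (a : H →L[ℂ] H) (x y : H →₀ ℂ)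
    (h : ∀ T : H →L[ℂ] H, Finsupp.linearCombination ℂ (fun v => inner ℂ v (T v)) x
      = Finsupp.linearCombination ℂ (fun v => inner ℂ v (T v)) y)
    {g : ℝ → ℂ} (hg : Measurable g) {M : ℝ} (hM : ∀ r, ‖g r‖ ≤ M) :
    Finsupp.linearCombination ℂ (fun v => ∫ r, g r ∂(spectralMeasure a v)) x
      = Finsupp.linearCombination ℂ (fun v => ∫ r, g r ∂(spectralMeasure a v)) y := by
  rw [← sub_eq_zero, ← map_sub]
  refine linearCombination_integral_eq_zero a _ (fun T => ?_) hg hM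
  rw [map_sub, h T, sub_self]

theorem norm_linearCombination_polarization_le (a : H →L[ℂ] H) {g : ℝ → ℂ} {M : ℝ}
    (hM0 : 0 ≤ M) (hM : ∀ r, ‖g r‖ ≤ M) (φ ψ : H) :
    ‖Finsupp.linearCombination ℂ (fun v => ∫ r, g r ∂(spectralMeasure a v)) (polarization φ ψ)‖
      ≤ M * (‖φ‖ + ‖ψ‖) ^ 2 := by
  have key : ∀ w : H, ‖w‖ ≤ ‖φ‖ + ‖ψ‖ →
      ‖∫ r, g r ∂(spectralMeasure a w)‖ ≤ M * (‖φ‖ + ‖ψ‖) ^ 2 := fun w hw =>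
    (norm_integral_spectralMeasure_le a w hM0 hM).trans (by gcongr)
  have k1 := key (φ + ψ) (norm_add_le _ _)
  have k2 := key (φ - ψ) (norm_sub_le _ _)
  have k3 := key (φ + Complex.I • ψ) ((norm_add_le _ _).trans (by simp [norm_smul]))
  have k4 := key (φ - Complex.I • ψ) ((norm_sub_le _ _).trans (by simp [norm_smul]))
  simp only [polarization, map_smul, map_add, map_sub, Finsupp.linearCombination_single,
    smul_eq_mul, one_mul]
  rw [norm_mul]
  have e : ‖(1 / 4 : ℂ)‖ = 1 / 4 := by norm_num
  rw [e]
  have k3' : ‖Complex.I * ∫ r, g r ∂(spectralMeasure a (φ + Complex.I • ψ))‖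
      ≤ M * (‖φ‖ + ‖ψ‖) ^ 2 := by rw [norm_mul, Complex.norm_I, one_mul]; exact k3
  have k4' : ‖Complex.I * ∫ r, g r ∂(spectralMeasure a (φ - Complex.I • ψ))‖
      ≤ M * (‖φ‖ + ‖ψ‖) ^ 2 := by rw [norm_mul, Complex.norm_I, one_mul]; exact k4
  have := norm_add_le_of_le (norm_sub_le_of_le (norm_sub_le_of_le k1 k2) k3') k4'
  linarith

/-- For a bounded Borel function `g` there is exactly one bounded operator `T` with
`⟨ψ, T ψ⟩ = ∫ g dμ_ψ` for all `ψ`. -/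
theorem existsUnique_borelCalculus (a : H →L[ℂ] H) {g : ℝ → ℂ} (hg : Measurable g)
    {M : ℝ} (hM : ∀ r, ‖g r‖ ≤ M) :
    ∃! T : H →L[ℂ] H, ∀ ψ, inner ℂ ψ (T ψ) = ∫ r, g r ∂(spectralMeasure a ψ) := by
  have hM0 : 0 ≤ M := (norm_nonneg _).trans (hM 0)
  let L := Finsupp.linearCombination ℂ (fun v => ∫ r, g r ∂(spectralMeasure a v))
  have hL : ∀ x y : H →₀ ℂ, (∀ T : H →L[ℂ] H,
      Finsupp.linearCombination ℂ (fun v => inner ℂ v (T v)) x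
      = Finsupp.linearCombination ℂ (fun v => inner ℂ v (T v)) y) → L x = L y :=
    fun x y h => linearCombination_integral_eq a x y h hg hM
  have smul_r : ∀ (c : ℂ) φ ψ, L (polarization φ (c • ψ)) = c * L (polarization φ ψ) := by
    intro c φ ψ
    rw [← smul_eq_mul, ← map_smul]
    refine hL _ _ fun T => ?_
    simp [linearCombination_polarization]
  have smul_l : ∀ (c : ℂ) φ ψ,
      L (polarization (c • φ) ψ) = (starRingEnd ℂ) c * L (polarization φ ψ) := by
    intro c φ ψ
    rw [← smul_eq_mul, ← map_smul]
    refine hL _ _ fun T => ?_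
    simp [linearCombination_polarization, mul_comm]
  let B : H →ₗ⋆[ℂ] H →ₗ[ℂ] ℂ := LinearMap.mk₂'ₛₗ (starRingEnd ℂ) (RingHom.id ℂ)
    (fun φ ψ => L (polarization φ ψ))
    (fun φ φ' ψ => by
      rw [← map_add]
      refine hL _ _ fun T => ?_
      simp [linearCombination_polarization])
    (fun c φ ψ => by rw [smul_l, smul_eq_mul])
    (fun φ ψ ψ' => by
      rw [← map_add]
      refine hL _ _ fun T => ?_
      simp [linearCombination_polarization])
    (fun c φ ψ => by rw [smul_r]; rfl)
  have hB : ∀ φ ψ, ‖B φ ψ‖ ≤ 4 * M * ‖φ‖ * ‖ψ‖ := by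
    intro φ ψ
    rcases eq_or_ne φ 0 with rfl | hφ
    · simp
    rcases eq_or_ne ψ 0 with rfl | hψ
    · simp
    have hφ' : (0 : ℝ) < ‖φ‖ := norm_pos_iff.2 hφ
    have hψ' : (0 : ℝ) < ‖ψ‖ := norm_pos_iff.2 hψ
    have h1 := norm_linearCombination_polarization_le a hM0 hM
      (((‖φ‖⁻¹ : ℝ) : ℂ) • φ) (((‖ψ‖⁻¹ : ℝ) : ℂ) • ψ)
    have n1 : ‖((‖φ‖⁻¹ : ℝ) : ℂ) • φ‖ = 1 := by
      rw [norm_smul]; simp [hφ'.ne']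
    have n2 : ‖((‖ψ‖⁻¹ : ℝ) : ℂ) • ψ‖ = 1 := by
      rw [norm_smul]; simp [hψ'.ne']
    rw [n1, n2] at h1
    change ‖L _‖ ≤ _ at h1
    rw [smul_l, smul_r] at h1
    change ‖L (polarization φ ψ)‖ ≤ _
    simp only [norm_mul, RCLike.norm_conj, Complex.norm_real, norm_inv, norm_norm] at h1
    rw [← mul_assoc, ← mul_inv, inv_mul_le_iff₀ (by positivity)] at h1
    linarith
  let Bc : H →L⋆[ℂ] H →L[ℂ] ℂ := LinearMap.mkContinuous₂ B (4 * M) hB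
  have hT : ∀ φ ψ, inner ℂ φ ((InnerProductSpace.continuousLinearMapOfBilin Bc).adjoint ψ)
      = L (polarization φ ψ) := by
    intro φ ψ
    rw [ContinuousLinearMap.adjoint_inner_right, InnerProductSpace.continuousLinearMapOfBilin_apply]
    rfl
  refine ⟨(InnerProductSpace.continuousLinearMapOfBilin Bc).adjoint, fun ψ => ?_, fun T hT' => ?_⟩
  · rw [hT]
    have : L (polarization ψ ψ) = L (Finsupp.single ψ 1) := hL _ _ fun T => by
      simp [linearCombination_polarization]
    rw [this]
    simp [L]
  · ext ψ
    refine ext_inner_left ℂ fun φ => ?_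
    rw [hT, ← linearCombination_polarization T φ ψ]
    simp only [hT']
    rfl

open Classical in
/-- The Borel functional calculus: for a bounded self-adjoint operator `a` and a bounded Borel
function `g`, the operator `g(a)` is the bounded operator determined by
`⟨ψ, g(a) ψ⟩ = ∫ g dμ_ψ` for all vectors `ψ`. -/
def borelCalculus (a : H →L[ℂ] H) (g : ℝ → ℂ) : H →L[ℂ] H :=
  if h : ∃ T : H →L[ℂ] H, ∀ ψ, inner ℂ ψ (T ψ) = ∫ r, g r ∂(spectralMeasure a ψ) then
    h.choose
  else 0

theorem inner_borelCalculus_self (a : H →L[ℂ] H) {g : ℝ → ℂ} (hg : Measurable g)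
    {M : ℝ} (hM : ∀ r, ‖g r‖ ≤ M) (ψ : H) :
    inner ℂ ψ (borelCalculus a g ψ) = ∫ r, g r ∂(spectralMeasure a ψ) := by
  have h := (existsUnique_borelCalculus a hg hM).exists
  rw [borelCalculus, dif_pos h]
  exact h.choose_spec ψ

/-- The spectral projection `χ_B(a)`. -/
def spectralProjection (a : H →L[ℂ] H) (B : Set ℝ) : H →L[ℂ] H :=
  borelCalculus a (B.indicator 1)

theorem inner_spectralProjection_self (a : H →L[ℂ] H) {B : Set ℝ} (hB : MeasurableSet B) (ψ : H) :
    inner ℂ ψ (spectralProjection a B ψ) = ((spectralMeasure a ψ).real B : ℂ) := by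
  rw [spectralProjection, inner_borelCalculus_self a (measurable_one.indicator hB) (M := 1)]
  · rw [integral_indicator hB]
    simp
  · intro r
    by_cases h : r ∈ B <;> simp [h]

theorem inner_spectralProjection (a : H →L[ℂ] H) {B : Set ℝ} (hB : MeasurableSet B) (φ ψ : H) :
    inner ℂ φ (spectralProjection a B ψ) = Finsupp.linearCombination ℂ
      (fun v => ((spectralMeasure a v).real B : ℂ)) (polarization φ ψ) := by
  rw [← linearCombination_polarization]
  simp only [inner_spectralProjection_self a hB]

open Classical in
/-- The mixed spectral measure `μ_{φ,ψ}(B) = ⟨φ, χ_B(a) ψ⟩`, a complex Borel measure on `ℝ`. -/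
def mixedSpectralMeasure (a : H →L[ℂ] H) (φ ψ : H) : ComplexMeasure ℝ where
  measureOf' B := if MeasurableSet B then inner ℂ φ (spectralProjection a B ψ) else 0
  empty' := by
    simp [inner_spectralProjection a MeasurableSet.empty, Finsupp.linearCombination_apply]
  not_measurable' B hB := by simp [hB]
  m_iUnion' f hf hd := by
    simp only [hf, MeasurableSet.iUnion hf, if_true, inner_spectralProjection a (hf _),
      inner_spectralProjection a (MeasurableSet.iUnion hf), Finsupp.linearCombination_apply,
      Finsupp.sum]
    refine hasSum_sum fun v _ => ?_
    have h := (spectralMeasure a v).toSignedMeasure.m_iUnion hf hd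
    simp only [Measure.toSignedMeasure_apply_measurable (hf _),
      Measure.toSignedMeasure_apply_measurable (MeasurableSet.iUnion hf)] at h
    exact (Complex.hasSum_ofReal.2 h).const_smul _

end FunctionalCalculus

/-! ### The Anderson model -/

section AndersonModel

variable {d : ℕ}

/-- The distance `|x - y| = ∑ᵢ |xᵢ - yᵢ|` on `ℤ^d`. -/
def latticeDist (x y : Fin d → ℤ) : ℤ := ∑ i, |x i - y i|

/-- The lattice vectors `k` with `|k| = 1`. -/
def unitVectors (d : ℕ) : Finset (Fin d → ℤ) :=
  (Finset.Icc (fun _ => -1) (fun _ => 1)).filter fun k => ∑ i, |k i| = 1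

theorem mem_unitVectors (k : Fin d → ℤ) : k ∈ unitVectors d ↔ ∑ i, |k i| = 1 := by
  simp only [unitVectors, Finset.mem_filter, Finset.mem_Icc, and_iff_right_iff_imp]
  intro h
  have h1 : ∀ i, |k i| ≤ 1 := fun i => h ▸
    Finset.single_le_sum (f := fun i => |k i|) (fun j _ => abs_nonneg (k j)) (Finset.mem_univ i)
  exact ⟨fun i => (abs_le.1 (h1 i)).1, fun i => (abs_le.1 (h1 i)).2⟩

/-- The Hilbert space `ℓ²(ℤ^d)`. -/
abbrev LatticeL2 (d : ℕ) : Type := lp (fun _ : Fin d → ℤ => ℂ) 2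

/-- The canonical basis vector `e_x` of `ℓ²(ℤ^d)`. -/
def basisVector (x : Fin d → ℤ) : LatticeL2 d := lp.single 2 x 1

theorem memℓp_comp_add (u : LatticeL2 d) (k : Fin d → ℤ) :
    Memℓp (fun n : Fin d → ℤ => u (n + k)) 2 := by
  have h := lp.memℓp u
  rw [memℓp_gen_iff (by norm_num)] at h ⊢
  exact h.comp_injective (add_left_injective k)

/-- The translation `(S_k u)(n) = u(n + k)` on `ℓ²(ℤ^d)`. -/
def shift (k : Fin d → ℤ) : LatticeL2 d →L[ℂ] LatticeL2 d :=
  LinearMap.mkContinuous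
    { toFun u := ⟨fun n => u (n + k), memℓp_comp_add u k⟩
      map_add' _ _ := rfl
      map_smul' _ _ := rfl }
    1
    fun u => by
      rw [one_mul, lp.norm_eq_tsum_rpow (by norm_num), lp.norm_eq_tsum_rpow (by norm_num)]
      exact le_of_eq (congrArg (fun t : ℝ => t ^ (1 / (2 : ℝ≥0∞).toReal))
        ((Equiv.addRight k).tsum_eq fun n => ‖u n‖ ^ (2 : ℝ≥0∞).toReal))

/-- The discrete Laplacian `(h₀ u)(n) = - ∑_{|k| = 1} u(n + k)`. -/
def discreteLaplacian (d : ℕ) : LatticeL2 d →L[ℂ] LatticeL2 d :=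
  -∑ k ∈ unitVectors d, shift k

theorem discreteLaplacian_apply (u : LatticeL2 d) (n : Fin d → ℤ) :
    discreteLaplacian d u n = -∑ k ∈ unitVectors d, u (n + k) := by
  simp only [discreteLaplacian, neg_apply, _root_.sum_apply, lp.coeFn_neg, Pi.neg_apply,
    lp.coeFn_sum, Finset.sum_apply]
  rfl

open Classical in
/-- The multiplication operator `(V u)(n) = v(n) u(n)` by a bounded real potential `v`. For
unbounded `v` the value is a placeholder; under a compactly supported single-site distribution
the potential is almost surely bounded. -/
def potentialOperator (v : (Fin d → ℤ) → ℝ) : LatticeL2 d →L[ℂ] LatticeL2 d :=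
  if h : ∃ K : ℝ, 0 ≤ K ∧ ∀ n, |v n| ≤ K then
    lp.mapCLM 2 (fun n => (v n : ℂ) • ContinuousLinearMap.id ℂ ℂ) h.choose_spec.1 (fun n => by
      rw [norm_smul, ContinuousLinearMap.norm_id, mul_one, Complex.norm_real]
      exact h.choose_spec.2 n)
  else 0

theorem potentialOperator_apply (v : (Fin d → ℤ) → ℝ) {K : ℝ} (hK : ∀ n, |v n| ≤ K)
    (u : LatticeL2 d) (n : Fin d → ℤ) : potentialOperator v u n = v n * u n := by
  have h : ∃ K : ℝ, 0 ≤ K ∧ ∀ n, |v n| ≤ K := ⟨K, (abs_nonneg _).trans (hK 0), hK⟩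
  rw [potentialOperator, dif_pos h]
  simp

/-- The Anderson Hamiltonian `h = h₀ + V` for the potential `v`. -/
def andersonHamiltonian (v : (Fin d → ℤ) → ℝ) : LatticeL2 d →L[ℂ] LatticeL2 d :=
  discreteLaplacian d + potentialOperator v

/-- The Green function `G(x, y; z) = ⟨e_x, (h - z)⁻¹ e_y⟩`. -/
def greenFunction (v : (Fin d → ℤ) → ℝ) (x y : Fin d → ℤ) (z : ℂ) : ℂ :=
  inner ℂ (basisVector x)
    (Ring.inverse (andersonHamiltonian v - z • ContinuousLinearMap.id ℂ (LatticeL2 d))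
      (basisVector y))

/-- `sup_t |⟨e_x, e^{-ith} χ_I(h) e_y⟩|`. -/
def timeSupremum (v : (Fin d → ℤ) → ℝ) (I : Set ℝ) (x y : Fin d → ℤ) : ℝ≥0∞ :=
  ⨆ t : ℝ, ‖inner ℂ (basisVector x)
    (borelCalculus (andersonHamiltonian v) (fun r => Complex.exp (-Complex.I * t * r))
      (spectralProjection (andersonHamiltonian v) I (basisVector y)))‖ₑ

/-- `sup_g |⟨e_x, g(h) χ_I(h) e_y⟩|` over all Borel functions `g : ℝ → ℂ` with `|g| ≤ 1`. -/
def borelSupremum (v : (Fin d → ℤ) → ℝ) (I : Set ℝ) (x y : Fin d → ℤ) : ℝ≥0∞ :=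
  ⨆ g : {g : ℝ → ℂ // Measurable g ∧ ∀ r, ‖g r‖ ≤ 1}, ‖inner ℂ (basisVector x)
    (borelCalculus (andersonHamiltonian v) g
      (spectralProjection (andersonHamiltonian v) I (basisVector y)))‖ₑ

/-- The total variation `|μ_{x,y}|(I)` of the mixed spectral measure
`μ_{x,y}(B) = ⟨e_x, χ_B(h) e_y⟩`. -/
def spectralVariation (v : (Fin d → ℤ) → ℝ) (I : Set ℝ) (x y : Fin d → ℤ) : ℝ≥0∞ :=
  (mixedSpectralMeasure (andersonHamiltonian v) (basisVector x) (basisVector y)).variation I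

variable {Ω : Type*} [MeasurableSpace Ω]

/-- The nonnegative random variables `X x y` satisfy `𝔼(X x y) ≤ C e^{-m |x - y|}` for all
`x, y`, with constants `C < ∞` and `m > 0`. -/
def ExponentialDecay (P : Measure Ω) (X : (Fin d → ℤ) → (Fin d → ℤ) → Ω → ℝ≥0∞) : Prop :=
  ∃ C m : ℝ, 0 < m ∧ ∀ x y, AEMeasurable (X x y) P ∧
    ∫⁻ o, X x y o ∂P ≤ ENNReal.ofReal (C * Real.exp (-m * latticeDist x y))

/-- Dynamical localization in `I` of the Anderson model with random potential `ω`. -/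
def DynamicalLocalization (P : Measure Ω) (ω : (Fin d → ℤ) → Ω → ℝ) (I : Set ℝ) : Prop :=
  ExponentialDecay P fun x y o => timeSupremum (fun n => ω n o) I x y

end AndersonModel

end

/-! The proof passes from fractional moments of the Green function to second moments weighted by
`ε`, and from these straight to the spectral measures. Neither eigenfunctions nor pure point
spectrum enter.

From fractional to second moments. As a function of the potential `t` at the single site `x`, the
rank-one resolvent formula gives `|G(n,x;E+iε)| = R / |t - w|` with `R`, `w` independent of `t`. The
Ward identity yields `Im w ≥ ε` and `Im w ≥ ε R²` (`exists_greenFunction_update`). Since `ρ` is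
bounded, averaging `ε R² / |t - w|²` over `t` costs at most a constant times `ε R² / Im w ≤ min 1 R²
≤ R^s`, while the average of `(R / |t - w|)^s` is at least `(R / (A + |w|))^s` when the law lives on
`[-A, A]`. Large `|w|` is treated separately. This is `lintegral_sq_le_lintegral_rpow`; integrating
over the other sites gives `lintegral_greenFunction_sq_le`, so `𝔼(ε |G(n,x;E+iε)|²)` decays
exponentially, uniformly in `0 < ε ≤ 1`.

From second moments to spectral measures. If `f` is continuous, bounded by one and zero outside `I`,
then `f(h)` is the weak limit of its Poisson integrals `π⁻¹ ∫ f(E) ε |h - E - iε|⁻² dE`. Hence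
`|⟨e_x, f(h) e_y⟩|` is at most the liminf of `∫_I ∑ₙ ε |G(n,x)| |G(n,y)| dE`. This bound does not
involve `f`, so it also holds for the supremum over all Borel `g` (`borelSupremum_le_liminf`).
Fatou, Tonelli and Cauchy–Schwarz in the probability space leave a sum over `n` of `e^{-m|n-x|/2}
e^{-m|n-y|/2}`, which decays in `|x - y|` (`lintegral_borelSupremum_le`).

The time supremum is dominated by the Borel supremum, and the total variation equals it
(`variation_mixedSpectralMeasure`). Measurability comes from polynomial approximation of continuous
functions of `h` and from replacing the suprema by countable ones. -/

noncomputable section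

open Filter Topology

/-! ### Borel functional calculus: convergence, multiplicativity, resolvents. -/

section BorelCalculus

variable {H : Type*} [NormedAddCommGroup H] [InnerProductSpace ℂ H] [CompleteSpace H]

/-- A bounded Borel function is the almost everywhere limit of continuous functions obeying the
same bound. -/
theorem exists_continuous_seq_tendsto_ae (ν : Measure ℝ) [IsFiniteMeasure ν]
    {g : ℝ → ℂ} (hg : Measurable g) {M : ℝ} (hM : ∀ r, ‖g r‖ ≤ M) :
    ∃ F : ℕ → ℝ → ℂ, (∀ n, Continuous (F n)) ∧ (∀ n r, ‖F n r‖ ≤ M) ∧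
      ∀ᵐ r ∂ν, Tendsto (fun n => F n r) atTop (𝓝 (g r)) := by
  have hM0 : 0 ≤ M := (norm_nonneg _).trans (hM 0)
  rcases hM0.eq_or_lt with rfl | hMpos
  · refine ⟨fun _ _ => 0, fun _ => continuous_const, fun _ _ => by simp, ?_⟩
    refine Eventually.of_forall fun r => ?_
    have : g r = 0 := norm_le_zero_iff.1 (hM r)
    simp [this]
  have hmem : MemLp g 1 ν := MemLp.of_bound hg.aestronglyMeasurable M (Eventually.of_forall hM)
  have hex : ∀ n : ℕ, ∃ f : ℝ → ℂ, eLpNorm (f - g) 1 ν ≤ ENNReal.ofReal (1 / ((n : ℝ) + 1)) ∧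
      Continuous f := by
    intro n
    obtain ⟨f, -, hf, hc, -⟩ := hmem.exists_hasCompactSupport_eLpNorm_sub_le (by simp)
      (ε := ENNReal.ofReal (1 / ((n : ℝ) + 1))) (by simp; positivity)
    exact ⟨f, by rwa [eLpNorm_sub_comm], hc⟩
  choose f hf hfc using hex
  have htends : Tendsto (fun n => eLpNorm (f n - g) 1 ν) atTop (𝓝 0) := by
    refine tendsto_of_tendsto_of_tendsto_of_le_of_le tendsto_const_nhds ?_
      (fun _ => bot_le) hf
    have := ENNReal.tendsto_ofReal (tendsto_one_div_add_atTop_nhds_zero_nat (𝕜 := ℝ))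
    simpa using this
  obtain ⟨ns, -, hns⟩ := (tendstoInMeasure_of_tendsto_eLpNorm one_ne_zero
    (fun n => (hfc n).aestronglyMeasurable) hg.aestronglyMeasurable htends).exists_seq_tendsto_ae
  -- Radial retraction onto the disc of radius `M`: it restores the bound lost in the `L¹`
  -- approximation and, fixing every value of `g`, preserves the limit. The division is why `M = 0`
  -- was split off.
  let c : ℂ → ℂ := fun z => ((M / max M ‖z‖ : ℝ) : ℂ) * z
  have hcc : Continuous c := by
    refine (Complex.continuous_ofReal.comp ?_).mul continuous_id
    refine continuous_const.div (by fun_prop) fun z => ?_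
    exact (hMpos.trans_le (le_max_left _ _)).ne'
  have hcb : ∀ z, ‖c z‖ ≤ M := by
    intro z
    have h0 : 0 < max M ‖z‖ := hMpos.trans_le (le_max_left _ _)
    simp only [c, norm_mul, Complex.norm_real, Real.norm_eq_abs]
    rw [abs_of_nonneg (by positivity), div_mul_eq_mul_div, div_le_iff₀ h0]
    gcongr
    exact le_max_right _ _
  have hci : ∀ z, ‖z‖ ≤ M → c z = z := by
    intro z hz
    simp [c, max_eq_left hz, hMpos.ne']
  refine ⟨fun n => c ∘ f (ns n), fun n => hcc.comp (hfc _), fun n r => hcb _, ?_⟩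
  filter_upwards [hns] with r hr
  have := (hcc.tendsto (g r)).comp hr
  rwa [hci _ (hM r)] at this

/-- A matrix element involves only the finitely many spectral measures of a polarization; their sum
is a finite measure dominating each of them. -/
theorem exists_continuous_seq_tendsto_ae_spectralMeasure (a : H →L[ℂ] H) (S : Finset H)
    {g : ℝ → ℂ} (hg : Measurable g) {M : ℝ} (hM : ∀ r, ‖g r‖ ≤ M) :
    ∃ F : ℕ → ℝ → ℂ, (∀ n, Continuous (F n)) ∧ (∀ n r, ‖F n r‖ ≤ M) ∧
      ∀ v ∈ S, ∀ᵐ r ∂(spectralMeasure a v), Tendsto (fun n => F n r) atTop (𝓝 (g r)) := by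
  obtain ⟨F, h1, h2, h3⟩ := exists_continuous_seq_tendsto_ae (∑ v ∈ S, spectralMeasure a v) hg hM
  refine ⟨F, h1, h2, fun v hv => ?_⟩
  have hle : spectralMeasure a v ≤ ∑ v ∈ S, spectralMeasure a v :=
    Finset.single_le_sum (f := fun v => spectralMeasure a v) (fun _ _ => Measure.zero_le _) hv
  exact (Measure.absolutelyContinuous_of_le hle).ae_le h3

theorem borelCalculus_eq_of_forall_inner (a : H →L[ℂ] H) {g : ℝ → ℂ} (hg : Measurable g)
    {M : ℝ} (hM : ∀ r, ‖g r‖ ≤ M) {T : H →L[ℂ] H}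
    (hT : ∀ ψ, inner ℂ ψ (T ψ) = ∫ r, g r ∂(spectralMeasure a ψ)) : borelCalculus a g = T :=
  (existsUnique_borelCalculus a hg hM).unique (inner_borelCalculus_self a hg hM) hT

theorem inner_borelCalculus (a : H →L[ℂ] H) {g : ℝ → ℂ} (hg : Measurable g)
    {M : ℝ} (hM : ∀ r, ‖g r‖ ≤ M) (φ ψ : H) :
    inner ℂ φ (borelCalculus a g ψ) = Finsupp.linearCombination ℂ
      (fun v => ∫ r, g r ∂(spectralMeasure a v)) (polarization φ ψ) := by
  rw [← linearCombination_polarization]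
  simp only [inner_borelCalculus_self a hg hM]

/-- Dominated convergence for each spectral measure in the polarization. All later passages from
continuous to Borel functions, and all continuity in parameters, go through this statement. -/
theorem tendsto_inner_borelCalculus (a : H →L[ℂ] H) {F : ℕ → ℝ → ℂ} {g : ℝ → ℂ}
    (hF : ∀ n, Measurable (F n)) (hg : Measurable g) {M : ℝ} (hFM : ∀ n r, ‖F n r‖ ≤ M)
    (hgM : ∀ r, ‖g r‖ ≤ M) (φ ψ : H)
    (h : ∀ v ∈ (polarization φ ψ).support, ∀ᵐ r ∂(spectralMeasure a v),
      Tendsto (fun n => F n r) atTop (𝓝 (g r))) :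
    Tendsto (fun n => inner ℂ φ (borelCalculus a (F n) ψ)) atTop
      (𝓝 (inner ℂ φ (borelCalculus a g ψ))) := by
  simp only [inner_borelCalculus a (hF _) (hFM _), inner_borelCalculus a hg hgM,
    Finsupp.linearCombination_apply, Finsupp.sum]
  refine tendsto_finsetSum _ fun v hv => Tendsto.const_smul ?_ _
  exact tendsto_integral_of_dominated_convergence (fun _ => M)
    (fun n => (hF n).aestronglyMeasurable) (integrable_const _)
    (fun n => Eventually.of_forall (hFM n)) (h v hv)

theorem borelCalculus_add (a : H →L[ℂ] H) {f g : ℝ → ℂ} (hf : Measurable f) (hg : Measurable g)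
    {M N : ℝ} (hfM : ∀ r, ‖f r‖ ≤ M) (hgN : ∀ r, ‖g r‖ ≤ N) :
    borelCalculus a (fun r => f r + g r) = borelCalculus a f + borelCalculus a g := by
  refine borelCalculus_eq_of_forall_inner a (hf.add hg)
    (fun r => norm_add_le_of_le (hfM r) (hgN r)) fun ψ => ?_
  rw [add_apply, inner_add_right, inner_borelCalculus_self a hf hfM,
    inner_borelCalculus_self a hg hgN]
  exact (integral_add (integrable_spectralMeasure a ψ hf hfM)
    (integrable_spectralMeasure a ψ hg hgN)).symm

theorem borelCalculus_const_mul (a : H →L[ℂ] H) {g : ℝ → ℂ} (hg : Measurable g)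
    {M : ℝ} (hM : ∀ r, ‖g r‖ ≤ M) (c : ℂ) :
    borelCalculus a (fun r => c * g r) = c • borelCalculus a g := by
  refine borelCalculus_eq_of_forall_inner a (hg.const_mul c) (M := ‖c‖ * M)
    (fun r => by rw [norm_mul]; gcongr; exact hM r) fun ψ => ?_
  rw [smul_apply, inner_smul_right, inner_borelCalculus_self a hg hM, integral_const_mul]

theorem adjoint_borelCalculus (a : H →L[ℂ] H) {g : ℝ → ℂ} (hg : Measurable g)
    {M : ℝ} (hM : ∀ r, ‖g r‖ ≤ M) :
    (borelCalculus a g).adjoint = borelCalculus a fun r => (starRingEnd ℂ) (g r) := by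
  refine (borelCalculus_eq_of_forall_inner a (Complex.continuous_conj.measurable.comp hg)
    (M := M) (fun r => by simpa using hM r) fun ψ => ?_).symm
  rw [ContinuousLinearMap.adjoint_inner_right, ← inner_conj_symm, inner_borelCalculus_self a hg hM,
    ← integral_conj]
  rfl

theorem inner_cfc_self_eq_integral (a : H →L[ℂ] H) (ψ : H) (f : C_c(ℝ, ℝ)) :
    inner ℂ ψ (cfc (fun r => f r) a ψ) = ((∫ r, f r ∂(spectralMeasure a ψ) : ℝ) : ℂ) := by
  rw [integral_spectralMeasure]
  have hsa : IsSelfAdjoint (cfc (fun r => f r) a) := cfc_predicate _ _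
  exact (hsa.isSymmetric.coe_re_inner_self_apply ψ).symm

theorem abs_le_norm_of_mem_spectrum (a : H →L[ℂ] H) {r : ℝ} (hr : r ∈ spectrum ℝ a) :
    |r| ≤ ‖a‖ := by
  have : Nontrivial H := by
    by_contra h
    have : Subsingleton H := not_nontrivial_iff_subsingleton.1 h
    have : Subsingleton (H →L[ℂ] H) := inferInstance
    simp [spectrum.of_subsingleton] at hr
  exact spectrum.norm_le_norm_of_mem hr

/-- By inner regularity it suffices to test compact subsets; a cutoff equal to one there and
supported in the open set vanishes on the spectrum, so its functional calculus is zero. -/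
theorem spectralMeasure_norm_lt_abs (a : H →L[ℂ] H) (ψ : H) :
    spectralMeasure a ψ {r | ‖a‖ < |r|} = 0 := by
  have ho : IsOpen {r : ℝ | ‖a‖ < |r|} := isOpen_lt continuous_const continuous_abs
  rw [ho.measure_eq_iSup_isCompact (spectralMeasure a ψ)]
  simp only [ENNReal.iSup_eq_zero]
  intro K hK hKc
  obtain ⟨f, hf1, hf2, hf3⟩ := exists_continuousMap_one_of_isCompact_subset_isOpen hKc ho hK
  let F : C_c(ℝ, ℝ) := ⟨f, hf2⟩
  have h1 := RealRMK.rieszMeasure_le_of_eq_one (spectralFunctional a ψ) (f := F)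
      (fun r => (hf3.2 r).1) hKc (fun r hr => hf1 hr)
  have h2 : cfc (fun r => F r) a = 0 := by
    rw [← cfc_zero (R := ℝ) a]
    refine cfc_congr fun r hr => ?_
    have := abs_le_norm_of_mem_spectrum a hr
    have hn : r ∉ tsupport f := fun h => absurd (hf3.1 h) (by simpa using this)
    exact image_eq_zero_of_notMem_tsupport hn
  have h3 : spectralFunctional a ψ F = 0 := by
    change (inner ℂ ψ (cfc (fun r => F r) a ψ)).re = 0
    simp [h2]
  rw [h3, ENNReal.ofReal_zero] at h1
  exact nonpos_iff_eq_zero.1 h1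

theorem ae_abs_le_norm (a : H →L[ℂ] H) (ψ : H) :
    ∀ᵐ r ∂(spectralMeasure a ψ), |r| ≤ ‖a‖ := by
  have := spectralMeasure_norm_lt_abs a ψ
  rw [ae_iff]
  simpa using this

theorem borelCalculus_congr_of_abs_le_norm (a : H →L[ℂ] H) {f g : ℝ → ℂ} (hf : Measurable f)
    (hg : Measurable g) {M : ℝ} (hfM : ∀ r, ‖f r‖ ≤ M) {N : ℝ} (hgN : ∀ r, ‖g r‖ ≤ N)
    (h : ∀ r, |r| ≤ ‖a‖ → f r = g r) : borelCalculus a f = borelCalculus a g := by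
  refine borelCalculus_eq_of_forall_inner a hf hfM fun ψ => ?_
  rw [inner_borelCalculus_self a hg hgN]
  refine integral_congr_ae ?_
  filter_upwards [ae_abs_le_norm a ψ] with r hr using (h r hr).symm

theorem inner_cfc_self_eq_integral_of_continuous (a : H →L[ℂ] H) (ψ : H) {f : ℝ → ℝ}
    (hf : Continuous f) :
    inner ℂ ψ (cfc f a ψ) = ((∫ r, f r ∂(spectralMeasure a ψ) : ℝ) : ℂ) := by
  obtain ⟨χ, hχ1, hχ2, -⟩ := exists_continuousMap_one_of_isCompact_subset_isOpen
    (isCompact_Icc (a := -‖a‖) (b := ‖a‖)) isOpen_univ (Set.subset_univ _)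
  -- Neither the calculus nor the spectral measure sees values outside `[-‖a‖, ‖a‖]`, so `f` may be
  -- cut off there to reach compact support.
  let F : C_c(ℝ, ℝ) := ⟨⟨fun r => f r * χ r, hf.mul χ.continuous⟩, HasCompactSupport.mul_left hχ2⟩
  have hF : ∀ r, |r| ≤ ‖a‖ → F r = f r := fun r hr => by
    change f r * χ r = f r
    rw [hχ1 (abs_le.1 hr)]
    simp
  have h1 : cfc f a = cfc (fun r => F r) a :=
    cfc_congr fun r hr => (hF r (abs_le_norm_of_mem_spectrum a hr)).symm
  have h2 : ∫ r, f r ∂(spectralMeasure a ψ) = ∫ r, F r ∂(spectralMeasure a ψ) := by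
    refine integral_congr_ae ?_
    filter_upwards [ae_abs_le_norm a ψ] with r hr using (hF r hr).symm
  rw [h1, h2, inner_cfc_self_eq_integral]

theorem borelCalculus_eq_cfc_add_cfc (a : H →L[ℂ] H) {f : ℝ → ℂ}
    (hf : Continuous f) {M : ℝ} (hM : ∀ r, ‖f r‖ ≤ M) :
    borelCalculus a f = cfc (fun r => (f r).re) a + Complex.I • cfc (fun r => (f r).im) a := by
  refine borelCalculus_eq_of_forall_inner a hf.measurable hM fun ψ => ?_
  rw [add_apply, smul_apply, inner_add_right, inner_smul_right,
    inner_cfc_self_eq_integral_of_continuous a ψ (f := fun r => (f r).re)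
      (Complex.continuous_re.comp hf),
    inner_cfc_self_eq_integral_of_continuous a ψ (f := fun r => (f r).im)
      (Complex.continuous_im.comp hf), mul_comm]
  exact integral_re_add_im (integrable_spectralMeasure a ψ hf.measurable hM)

/-- Passing to the complex calculus makes products of complex-valued functions available;
precomposing with the real part extends `f` continuously to the plane. -/
theorem borelCalculus_eq_cfc (a : H →L[ℂ] H) (ha : IsSelfAdjoint a) {f : ℝ → ℂ}
    (hf : Continuous f) {M : ℝ} (hM : ∀ r, ‖f r‖ ≤ M) :
    borelCalculus a f = cfc (fun z : ℂ => f z.re) a := by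
  have hre : Continuous fun r => (f r).re := Complex.continuous_re.comp hf
  have him : Continuous fun r => (f r).im := Complex.continuous_im.comp hf
  have hc : ∀ u : ℝ → ℝ, Continuous u → Continuous fun z : ℂ => ((u z.re : ℝ) : ℂ) :=
    fun u hu => Complex.continuous_ofReal.comp (hu.comp Complex.continuous_re)
  rw [borelCalculus_eq_cfc_add_cfc a hf hM, cfc_real_eq_complex (fun r => (f r).re) ha,
    cfc_real_eq_complex (fun r => (f r).im) ha,
    ← cfc_smul Complex.I _ a (hc _ him).continuousOn,
    ← cfc_add (a := a) _ (fun z : ℂ => Complex.I • (((f z.re).im : ℝ) : ℂ))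
      (hc _ hre).continuousOn ((hc _ him).const_smul Complex.I).continuousOn]
  refine cfc_congr fun z _ => ?_
  simp only [smul_eq_mul]
  rw [mul_comm]
  exact Complex.re_add_im _

theorem borelCalculus_mul_of_continuous (a : H →L[ℂ] H) (ha : IsSelfAdjoint a) {f g : ℝ → ℂ}
    (hf : Continuous f) (hg : Continuous g) {M N : ℝ} (hfM : ∀ r, ‖f r‖ ≤ M)
    (hgN : ∀ r, ‖g r‖ ≤ N) :
    borelCalculus a (fun r => f r * g r) = borelCalculus a f * borelCalculus a g := by
  rw [borelCalculus_eq_cfc a ha hf hfM, borelCalculus_eq_cfc a ha hg hgN,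
    borelCalculus_eq_cfc a ha (f := fun r => f r * g r) (hf.mul hg) (M := M * N)]
  · exact cfc_mul (R := ℂ) (fun z => f z.re) (fun z => g z.re) a
      (hf.comp Complex.continuous_re).continuousOn (hg.comp Complex.continuous_re).continuousOn
  · intro r
    rw [norm_mul]
    exact mul_le_mul (hfM r) (hgN r) (norm_nonneg _) ((norm_nonneg _).trans (hfM r))

/-- The Borel functional calculus is multiplicative. -/
theorem borelCalculus_mul (a : H →L[ℂ] H) (ha : IsSelfAdjoint a) {f g : ℝ → ℂ}
    (hf : Measurable f) (hg : Measurable g) {M N : ℝ} (hfM : ∀ r, ‖f r‖ ≤ M)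
    (hgN : ∀ r, ‖g r‖ ≤ N) :
    borelCalculus a (fun r => f r * g r) = borelCalculus a f * borelCalculus a g := by
  classical
  have hb : ∀ {u v : ℝ → ℂ}, (∀ r, ‖u r‖ ≤ M) → (∀ r, ‖v r‖ ≤ N) → ∀ r, ‖u r * v r‖ ≤ M * N := by
    intro u v hu hv r
    rw [norm_mul]
    exact mul_le_mul (hu r) (hv r) (norm_nonneg _) ((norm_nonneg _).trans (hu r))
  -- The factors are extended from continuous to Borel one at a time, first the right one. Moving
  -- `u(a)` to the left vector by its adjoint turns the product into an ordinary matrix element, to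
  -- which the convergence theorem applies.
  have step : ∀ {u : ℝ → ℂ}, Continuous u → (∀ r, ‖u r‖ ≤ M) →
      borelCalculus a (fun r => u r * g r) = borelCalculus a u * borelCalculus a g := by
    intro u hu huM
    ext ψ
    refine ext_inner_left ℂ fun φ => ?_
    obtain ⟨F, h1, h2, h3⟩ := exists_continuous_seq_tendsto_ae_spectralMeasure a
      ((polarization φ ψ).support ∪
        (polarization ((borelCalculus a u).adjoint φ) ψ).support) hg hgN
    have t1 := tendsto_inner_borelCalculus a (F := fun n r => u r * F n r)
      (fun n => hu.measurable.mul (h1 n).measurable) (hu.measurable.mul hg)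
      (fun n => hb huM (h2 n)) (hb huM hgN) φ ψ (fun v hv => by
        filter_upwards [h3 v (Finset.mem_union_left _ hv)] with r hr using hr.const_mul _)
    have t2 := tendsto_inner_borelCalculus a (fun n => (h1 n).measurable) hg h2 hgN
      ((borelCalculus a u).adjoint φ) ψ (fun v hv => h3 v (Finset.mem_union_right _ hv))
    simp only [borelCalculus_mul_of_continuous a ha hu (h1 _) huM (h2 _)] at t1
    simp only [ContinuousLinearMap.adjoint_inner_left] at t2
    exact tendsto_nhds_unique t1 t2
  ext ψ
  refine ext_inner_left ℂ fun φ => ?_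
  obtain ⟨F, h1, h2, h3⟩ := exists_continuous_seq_tendsto_ae_spectralMeasure a
    ((polarization φ ψ).support ∪ (polarization φ (borelCalculus a g ψ)).support) hf hfM
  have t1 := tendsto_inner_borelCalculus a (F := fun n r => F n r * g r)
    (fun n => (h1 n).measurable.mul hg) (hf.mul hg)
    (fun n => hb (h2 n) hgN) (hb hfM hgN) φ ψ (fun v hv => by
      filter_upwards [h3 v (Finset.mem_union_left _ hv)] with r hr using hr.mul_const _)
  have t2 := tendsto_inner_borelCalculus a (fun n => (h1 n).measurable) hf h2 hfM
    φ (borelCalculus a g ψ) (fun v hv => h3 v (Finset.mem_union_right _ hv))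
  simp only [step (h1 _) (h2 _)] at t1
  exact tendsto_nhds_unique t1 t2

theorem inv_sub_continuous {z : ℂ} (hz : z.im ≠ 0) : Continuous fun r : ℝ => ((r : ℂ) - z)⁻¹ := by
  refine (Complex.continuous_ofReal.sub continuous_const).inv₀ fun r h => hz ?_
  have := congrArg Complex.im h
  simpa using this

theorem norm_inv_sub_le {z : ℂ} (hz : z.im ≠ 0) (r : ℝ) : ‖((r : ℂ) - z)⁻¹‖ ≤ |z.im|⁻¹ := by
  rw [norm_inv]
  refine inv_anti₀ (abs_pos.2 hz) ?_
  have := Complex.abs_im_le_norm ((r : ℂ) - z)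
  simpa using this

theorem borelCalculus_resolvent (a : H →L[ℂ] H) (ha : IsSelfAdjoint a) {z : ℂ} (hz : z.im ≠ 0) :
    (a - z • ContinuousLinearMap.id ℂ H) * borelCalculus a (fun r => ((r : ℂ) - z)⁻¹) = 1 ∧
    borelCalculus a (fun r => ((r : ℂ) - z)⁻¹) * (a - z • ContinuousLinearMap.id ℂ H) = 1 := by
  have hspec : ∀ w ∈ spectrum ℂ a, ((w.re : ℝ) : ℂ) = w := fun w hw =>
    (ha.mem_spectrum_eq_re hw).symm
  have hsub : ∀ r : ℝ, (r : ℂ) - z ≠ 0 := fun r h => hz (by simpa using congrArg Complex.im h)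
  -- On the real spectrum `w.re = w`, while `w ↦ w.re - z` has no zero anywhere in the plane, so its
  -- inverse is globally continuous.
  have e1 : a - z • ContinuousLinearMap.id ℂ H = cfc (fun w : ℂ => (w.re : ℂ) - z) a := by
    have : cfc (fun w : ℂ => (w.re : ℂ) - z) a = cfc (fun w : ℂ => w - z) a :=
      cfc_congr fun w hw => by rw [hspec w hw]
    rw [this, cfc_sub (R := ℂ) (fun w => w) (fun _ => z) a, cfc_id' ℂ a, cfc_const z a]
    rfl
  have hc1 : Continuous fun w : ℂ => (w.re : ℂ) - z := by fun_prop
  have hc2 : Continuous fun w : ℂ => ((w.re : ℂ) - z)⁻¹ :=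
    (inv_sub_continuous hz).comp Complex.continuous_re
  rw [e1, borelCalculus_eq_cfc a ha (inv_sub_continuous hz) (norm_inv_sub_le hz),
    ← cfc_mul _ _ a hc1.continuousOn hc2.continuousOn,
    ← cfc_mul _ _ a hc2.continuousOn hc1.continuousOn]
  constructor
  · simpa only [mul_inv_cancel₀ (hsub _)] using cfc_const_one ℂ a
  · simpa only [inv_mul_cancel₀ (hsub _)] using cfc_const_one ℂ a

theorem inverse_eq_borelCalculus (a : H →L[ℂ] H) (ha : IsSelfAdjoint a) {z : ℂ} (hz : z.im ≠ 0) :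
    Ring.inverse (a - z • ContinuousLinearMap.id ℂ H)
      = borelCalculus a (fun r => ((r : ℂ) - z)⁻¹) := by
  obtain ⟨h1, h2⟩ := borelCalculus_resolvent a ha hz
  exact Ring.inverse_unit ⟨_, _, h1, h2⟩

end BorelCalculus

/-! ### Total variation of mixed spectral measures as a supremum over Borel functions. -/

section Variation

variable {H : Type*} [NormedAddCommGroup H] [InnerProductSpace ℂ H] [CompleteSpace H]

theorem norm_indicator_one_le (B : Set ℝ) (r : ℝ) : ‖B.indicator (1 : ℝ → ℂ) r‖ ≤ 1 := by
  by_cases h : r ∈ B <;> simp [h]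

theorem borelCalculus_zero (a : H →L[ℂ] H) : borelCalculus a (fun _ => 0) = 0 :=
  borelCalculus_eq_of_forall_inner a measurable_const (M := 0) (fun _ => by simp) (by simp)

theorem borelCalculus_sum (a : H →L[ℂ] H) {ι : Type*} (s : Finset ι) {f : ι → ℝ → ℂ}
    (hf : ∀ i, Measurable (f i)) {M : ι → ℝ} (hM : ∀ i r, ‖f i r‖ ≤ M i) :
    borelCalculus a (fun r => ∑ i ∈ s, f i r) = ∑ i ∈ s, borelCalculus a (f i) := by
  classical
  induction s using Finset.induction_on with
  | empty => simpa using borelCalculus_zero a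
  | insert i s hi ih =>
    simp only [Finset.sum_insert hi]
    rw [borelCalculus_add a (hf i) (Finset.measurable_sum s fun j _ => hf j) (hM i)
      (fun r => norm_sum_le_of_le s fun j _ => hM j r), ih]

theorem borelCalculus_mul_spectralProjection (a : H →L[ℂ] H) (ha : IsSelfAdjoint a) {g : ℝ → ℂ}
    (hg : Measurable g) {M : ℝ} (hM : ∀ r, ‖g r‖ ≤ M) {I : Set ℝ} (hI : MeasurableSet I) (ψ : H) :
    borelCalculus a g (spectralProjection a I ψ)
      = borelCalculus a (fun r => g r * I.indicator 1 r) ψ := by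
  rw [borelCalculus_mul a ha hg (measurable_one.indicator hI) hM (norm_indicator_one_le I)]
  rfl

theorem mixedSpectralMeasure_apply (a : H →L[ℂ] H) (φ ψ : H) {B : Set ℝ} (hB : MeasurableSet B) :
    mixedSpectralMeasure a φ ψ B = inner ℂ φ (borelCalculus a (B.indicator 1) ψ) :=
  if_pos hB

/-- The fibres of `f` partition `I`; on each of them the contribution is a value of modulus at most
one times the mixed measure of the fibre, and the variation is additive. -/
theorem inner_simpleFunc_le_variation (a : H →L[ℂ] H) (φ ψ : H) {I : Set ℝ} (hI : MeasurableSet I)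
    (f : SimpleFunc ℝ ℂ) (hf : ∀ r, ‖f r‖ ≤ 1) :
    ‖inner ℂ φ (borelCalculus a (fun r => f r * I.indicator 1 r) ψ)‖ₑ
      ≤ (mixedSpectralMeasure a φ ψ).variation I := by
  classical
  have hB : ∀ c, MeasurableSet (f ⁻¹' {c} ∩ I) := fun c => (f.measurableSet_fiber c).inter hI
  have e : (fun r => f r * I.indicator 1 r)
      = fun r => ∑ c ∈ f.range, c * (f ⁻¹' {c} ∩ I).indicator 1 r := by
    ext r
    rw [Finset.sum_eq_single_of_mem (f r) (f.mem_range_self r)]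
    · by_cases h : r ∈ I <;> simp [h]
    · intro c _ hc
      simp [Ne.symm hc]
  rw [e, borelCalculus_sum a f.range (f := fun c r => c * (f ⁻¹' {c} ∩ I).indicator 1 r)
    (M := fun c => ‖c‖ * 1) (fun c => (measurable_one.indicator (hB c)).const_mul c)
    (fun c r => by rw [norm_mul]; gcongr; exact norm_indicator_one_le _ _)]
  have e2 : ∀ c, borelCalculus a (fun r => c * (f ⁻¹' {c} ∩ I).indicator 1 r)
      = c • borelCalculus a ((f ⁻¹' {c} ∩ I).indicator 1) := fun c =>
    borelCalculus_const_mul a (measurable_one.indicator (hB c)) (norm_indicator_one_le _) c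
  simp only [e2, _root_.sum_apply, smul_apply, inner_sum, inner_smul_right,
    ← mixedSpectralMeasure_apply a φ ψ (hB _)]
  calc _ ≤ ∑ c ∈ f.range, ‖c * mixedSpectralMeasure a φ ψ (f ⁻¹' {c} ∩ I)‖ₑ := enorm_sum_le _ _
    _ ≤ ∑ c ∈ f.range, (mixedSpectralMeasure a φ ψ).variation (f ⁻¹' {c} ∩ I) := by
        refine Finset.sum_le_sum fun c hc => ?_
        obtain ⟨r, rfl⟩ := SimpleFunc.mem_range.1 hc
        rw [enorm_mul]
        have h1 : ‖f r‖ₑ ≤ 1 := by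
          rw [← ofReal_norm]
          exact ENNReal.ofReal_le_one.2 (hf r)
        calc _ ≤ 1 * _ := mul_le_mul' h1 (VectorMeasure.enorm_measure_le_variation _ _)
          _ = _ := one_mul _
    _ = (mixedSpectralMeasure a φ ψ).variation (⋃ c ∈ f.range, f ⁻¹' {c} ∩ I) := by
        refine (measure_biUnion_finset (fun c _ c' _ hcc => ?_) fun c _ => hB c).symm
        refine Set.disjoint_left.2 fun r hr hr' => hcc ?_
        exact hr.1.symm.trans hr'.1
    _ ≤ _ := measure_mono (Set.iUnion₂_subset fun c _ => Set.inter_subset_right)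

theorem inner_borelCalculus_le_variation (a : H →L[ℂ] H) (φ ψ : H) {I : Set ℝ}
    (hI : MeasurableSet I) {g : ℝ → ℂ} (hg : Measurable g) (hM : ∀ r, ‖g r‖ ≤ 1) :
    ‖inner ℂ φ (borelCalculus a (fun r => g r * I.indicator 1 r) ψ)‖ₑ
      ≤ (mixedSpectralMeasure a φ ψ).variation I := by
  have hb : ∀ u : ℝ → ℂ, (∀ r, ‖u r‖ ≤ 1) → ∀ r, ‖u r * I.indicator 1 r‖ ≤ 1 := fun u hu r => by
    rw [norm_mul]
    exact mul_le_one₀ (hu r) (norm_nonneg _) (norm_indicator_one_le I r)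
  have hsg := hg.stronglyMeasurable
  have hF : ∀ n r, ‖hsg.approxBounded 1 n r‖ ≤ 1 := fun n r =>
    hsg.norm_approxBounded_le zero_le_one n r
  have hIm : Measurable (I.indicator (1 : ℝ → ℂ)) := measurable_one.indicator hI
  have t := tendsto_inner_borelCalculus a
    (F := fun n r => hsg.approxBounded 1 n r * I.indicator 1 r)
    (fun n => (hsg.approxBounded 1 n).measurable.mul hIm) (hg.mul hIm) (fun n => hb _ (hF n))
    (hb g hM) φ ψ
    (fun v _ => Eventually.of_forall fun r =>
      (hsg.tendsto_approxBounded_of_norm_le (hM r)).mul_const _)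
  exact le_of_tendsto (continuous_enorm.tendsto _ |>.comp t) (Eventually.of_forall fun n =>
    inner_simpleFunc_le_variation a φ ψ hI _ (hF n))

theorem exists_norm_one_mul_eq_norm (w : ℂ) : ∃ c : ℂ, ‖c‖ = 1 ∧ c * w = ‖w‖ := by
  rcases eq_or_ne w 0 with rfl | hw
  · exact ⟨1, by simp⟩
  · refine ⟨(‖w‖ : ℂ) / w, by simp [hw], ?_⟩
    rw [div_mul_cancel₀ _ hw]

theorem variation_mixedSpectralMeasure (a : H →L[ℂ] H) (ha : IsSelfAdjoint a) (φ ψ : H)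
    {I : Set ℝ} (hI : MeasurableSet I) :
    (mixedSpectralMeasure a φ ψ).variation I
      = ⨆ g : {g : ℝ → ℂ // Measurable g ∧ ∀ r, ‖g r‖ ≤ 1},
        ‖inner ℂ φ (borelCalculus a g (spectralProjection a I ψ))‖ₑ := by
  classical
  refine le_antisymm (le_of_forall_lt fun t ht => ?_) (iSup_le fun g => ?_)
  · obtain ⟨P, hP1, hP2, hP3, hP4⟩ := VectorMeasure.exists_lt_sum_of_lt_variation _ hI ht
    choose c hc1 hc2 using exists_norm_one_mul_eq_norm
    let κ := mixedSpectralMeasure a φ ψ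
    -- On each piece of a nearly optimal disjoint family, `g` is the phase that rotates the mixed
    -- measure of that piece to its modulus, so that testing against `g` gives exactly the sum of
    -- moduli.
    let g : ℝ → ℂ := fun r => ∑ p : P, c (κ p) * (p : Set ℝ).indicator 1 r
    have hPm : ∀ p : P, Measurable fun r => c (κ p) * (p : Set ℝ).indicator 1 r := fun p =>
      (measurable_one.indicator (hP3 p p.2)).const_mul _
    have hg : Measurable g := Finset.measurable_sum _ fun p _ => hPm p
    have hPb : ∀ (p : P) r, ‖c (κ p) * (p : Set ℝ).indicator 1 r‖ ≤ 1 := fun p r => by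
      rw [norm_mul, hc1, one_mul]
      exact norm_indicator_one_le _ _
    have hg1 : ∀ r, ‖g r‖ ≤ 1 := by
      intro r
      by_cases hr : ∃ p : P, r ∈ (p : Set ℝ)
      · obtain ⟨p, hp⟩ := hr
        have : g r = c (κ p) * (p : Set ℝ).indicator 1 r := by
          refine Finset.sum_eq_single_of_mem p (Finset.mem_univ _) fun q _ hq => ?_
          have hd := hP2 q.2 p.2 fun h => hq (Subtype.ext h)
          have : r ∉ (q : Set ℝ) := fun h => Set.disjoint_left.1 hd h hp
          simp [this]
        rw [this]
        exact hPb p r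
      · have : g r = 0 := Finset.sum_eq_zero fun p _ => by
          have : r ∉ (p : Set ℝ) := fun h => hr ⟨p, h⟩
          simp [this]
        simp [this]
    refine hP4.trans_le (le_trans (le_of_eq ?_) (le_iSup _ ⟨g, hg, hg1⟩))
    change _ = ‖inner ℂ φ (borelCalculus a g (spectralProjection a I ψ))‖ₑ
    have hgI : (fun r => g r * I.indicator 1 r) = g := by
      ext r
      by_cases hr : r ∈ I
      · simp [hr]
      · have : g r = 0 := Finset.sum_eq_zero fun p _ => by
          have : r ∉ (p : Set ℝ) := fun h => hr (hP1 p p.2 h)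
          simp [this]
        simp [this]
    rw [borelCalculus_mul_spectralProjection a ha hg hg1 hI, hgI]
    have e1 : borelCalculus a g = ∑ p : P, c (κ p) • borelCalculus a ((p : Set ℝ).indicator 1) := by
      rw [borelCalculus_sum a Finset.univ hPm hPb]
      exact Finset.sum_congr rfl fun p _ => borelCalculus_const_mul a
        (measurable_one.indicator (hP3 p p.2)) (norm_indicator_one_le _) _
    have e2 : inner ℂ φ (borelCalculus a g ψ) = ((∑ p : P, ‖κ p‖ : ℝ) : ℂ) := by
      rw [e1]
      simp only [_root_.sum_apply, smul_apply, inner_sum, inner_smul_right, Complex.ofReal_sum]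
      refine Finset.sum_congr rfl fun p _ => ?_
      rw [← mixedSpectralMeasure_apply a φ ψ (hP3 p p.2)]
      exact hc2 _
    have hs : 0 ≤ ∑ p : P, ‖κ p‖ := Finset.sum_nonneg fun _ _ => norm_nonneg _
    rw [e2, ← ofReal_norm, Complex.norm_real, Real.norm_of_nonneg hs,
      ENNReal.ofReal_sum_of_nonneg fun _ _ => norm_nonneg _, ← Finset.sum_coe_sort P]
    exact Finset.sum_congr rfl fun p _ => (ofReal_norm _).symm
  · rw [borelCalculus_mul_spectralProjection a ha g.2.1 g.2.2 hI]
    exact inner_borelCalculus_le_variation a φ ψ hI g.2.1 g.2.2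

end Variation

/-! ### Poisson integrals and the resolvent bound for matrix elements. -/

section Poisson

variable {H : Type*} [NormedAddCommGroup H] [InnerProductSpace ℂ H] [CompleteSpace H]

/-- The Poisson kernel `ε / ((r - E)² + ε²)`, without the factor `π⁻¹`. -/
def lorentzKernel (ε E r : ℝ) : ℂ := ((ε * ((r - E) ^ 2 + ε ^ 2)⁻¹ : ℝ) : ℂ)

theorem continuous_lorentzKernel {ε : ℝ} (hε : 0 < ε) :
    Continuous fun p : ℝ × ℝ => lorentzKernel ε p.1 p.2 := by
  refine Complex.continuous_ofReal.comp (continuous_const.mul (Continuous.inv₀ (by fun_prop) ?_))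
  intro p
  positivity

theorem norm_lorentzKernel_le {ε : ℝ} (hε : 0 < ε) (E r : ℝ) : ‖lorentzKernel ε E r‖ ≤ ε⁻¹ := by
  rw [lorentzKernel, Complex.norm_real, Real.norm_of_nonneg (by positivity)]
  calc ε * ((r - E) ^ 2 + ε ^ 2)⁻¹ ≤ ε * (ε ^ 2)⁻¹ := by
        gcongr
        have := sq_nonneg (r - E)
        linarith
    _ = ε⁻¹ := by field_simp

theorem lorentzKernel_eq (ε E r : ℝ) :
    lorentzKernel ε E r = ε * ((starRingEnd ℂ) ((r : ℂ) - (E + ε * Complex.I))⁻¹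
      * ((r : ℂ) - (E + ε * Complex.I))⁻¹) := by
  rw [← Complex.normSq_eq_conj_mul_self, Complex.normSq_inv, Complex.normSq_apply, lorentzKernel]
  simp only [Complex.sub_re, Complex.sub_im, Complex.add_re, Complex.add_im, Complex.mul_re,
    Complex.mul_im, Complex.ofReal_re, Complex.ofReal_im, Complex.I_re, Complex.I_im]
  push_cast
  ring_nf

/-- The Poisson integral of `f`. -/
def poissonIntegral (f : ℝ → ℂ) (ε r : ℝ) : ℂ := (Real.pi : ℂ)⁻¹ * ∫ E, f E * lorentzKernel ε E r

/-- Substituting `E = r + ε u` moves `ε` from the kernel into the argument of `f`. The bound by one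
and the limit `ε → 0` are then immediate, since the remaining weight has integral `π`. -/
theorem poissonIntegral_eq (f : ℝ → ℂ) {ε : ℝ} (hε : 0 < ε) (r : ℝ) :
    poissonIntegral f ε r
      = (Real.pi : ℂ)⁻¹ * ∫ u, f (r + ε * u) * (((1 + u ^ 2)⁻¹ : ℝ) : ℂ) := by
  rw [poissonIntegral]
  congr 1
  have h1 := Measure.integral_comp_mul_left
    (fun t => f (r + t) * lorentzKernel ε (r + t) r) ε
  have h2 := integral_add_left_eq_self (μ := volume) (fun E => f E * lorentzKernel ε E r) r
  rw [h2, abs_of_pos (inv_pos.2 hε)] at h1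
  have h3 : ∀ u : ℝ, f (r + ε * u) * lorentzKernel ε (r + ε * u) r
      = ε⁻¹ • (f (r + ε * u) * (((1 + u ^ 2)⁻¹ : ℝ) : ℂ)) := by
    intro u
    have : ε * ((r - (r + ε * u)) ^ 2 + ε ^ 2)⁻¹ = ε⁻¹ * (1 + u ^ 2)⁻¹ := by
      have : (r - (r + ε * u)) ^ 2 + ε ^ 2 = ε ^ 2 * (1 + u ^ 2) := by ring
      rw [this]
      field_simp
    rw [lorentzKernel, this, Complex.real_smul]
    push_cast
    ring
  simp only [h3] at h1
  rw [integral_smul] at h1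
  exact ((smul_right_injective ℂ (inv_pos.2 hε).ne') h1).symm

theorem norm_poissonIntegral_le {f : ℝ → ℂ} (hM : ∀ r, ‖f r‖ ≤ 1) {ε : ℝ} (hε : 0 < ε) (r : ℝ) :
    ‖poissonIntegral f ε r‖ ≤ 1 := by
  rw [poissonIntegral_eq f hε, norm_mul, norm_inv, Complex.norm_real,
    Real.norm_of_nonneg Real.pi_pos.le, inv_mul_le_iff₀ Real.pi_pos, mul_one,
    ← integral_univ_inv_one_add_sq]
  refine norm_integral_le_of_norm_le integrable_inv_one_add_sq (Eventually.of_forall fun u => ?_)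
  rw [norm_mul, Complex.norm_real, Real.norm_of_nonneg (by positivity)]
  exact mul_le_of_le_one_left (by positivity) (hM _)

theorem tendsto_poissonIntegral {f : ℝ → ℂ} (hf : Continuous f) (hM : ∀ r, ‖f r‖ ≤ 1) {ε : ℕ → ℝ}
    (hε : ∀ n, 0 < ε n) (hε0 : Tendsto ε atTop (𝓝 0)) (r : ℝ) :
    Tendsto (fun n => poissonIntegral f (ε n) r) atTop (𝓝 (f r)) := by
  have h : f r = (Real.pi : ℂ)⁻¹ * ∫ u : ℝ, f r * (((1 + u ^ 2)⁻¹ : ℝ) : ℂ) := by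
    rw [integral_const_mul, integral_complex_ofReal, integral_univ_inv_one_add_sq]
    have : (Real.pi : ℂ) ≠ 0 := by exact_mod_cast Real.pi_ne_zero
    field_simp
  rw [h]
  simp only [poissonIntegral_eq f (hε _)]
  refine Tendsto.const_mul _ (tendsto_integral_of_dominated_convergence (fun u => (1 + u ^ 2)⁻¹)
    (fun n => ?_) integrable_inv_one_add_sq (fun n => Eventually.of_forall fun u => ?_)
    (Eventually.of_forall fun u => ?_))
  · have h1 : Continuous fun u : ℝ => (1 + u ^ 2)⁻¹ :=
      Continuous.inv₀ (by fun_prop) fun u => by positivity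
    exact ((hf.comp (by fun_prop)).mul (Complex.continuous_ofReal.comp h1)).aestronglyMeasurable
  · rw [norm_mul, Complex.norm_real, Real.norm_of_nonneg (by positivity)]
    exact mul_le_of_le_one_left (by positivity) (hM _)
  · refine Tendsto.mul_const _ ((hf.tendsto r).comp ?_)
    have := (hε0.mul_const u).const_add r
    simpa using this

theorem integrable_mul_lorentzKernel (μ : Measure ℝ) [IsFiniteMeasure μ] {f : ℝ → ℂ}
    (hf : Continuous f) (hM : ∀ r, ‖f r‖ ≤ 1) {ε : ℝ} (hε : 0 < ε) (a b : ℝ) :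
    Integrable (fun p : ℝ × ℝ => f p.1 * lorentzKernel ε p.1 p.2)
      ((volume.restrict (Set.Ioo a b)).prod μ) := by
  have : IsFiniteMeasure (volume.restrict (Set.Ioo a b)) := ⟨by simp⟩
  refine Integrable.of_bound
    ((hf.comp continuous_fst).mul (continuous_lorentzKernel hε)).aestronglyMeasurable ε⁻¹
    (Eventually.of_forall fun p => ?_)
  rw [norm_mul]
  exact (mul_le_of_le_one_left (norm_nonneg _) (hM _)).trans (norm_lorentzKernel_le hε _ _)

theorem poissonIntegral_eq_setIntegral {f : ℝ → ℂ} {a b : ℝ} (hI : ∀ r ∉ Set.Ioo a b, f r = 0)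
    (ε r : ℝ) : poissonIntegral f ε r
      = (Real.pi : ℂ)⁻¹ * ∫ E in Set.Ioo a b, f E * lorentzKernel ε E r := by
  rw [poissonIntegral, setIntegral_eq_integral_of_forall_compl_eq_zero]
  intro E hE
  rw [hI E hE, zero_mul]

/-- The kernel is `ε` times the squared modulus of the resolvent function; multiplicativity splits
it and the adjoint moves the conjugate factor to the left vector. -/
theorem inner_borelCalculus_lorentzKernel (T : H →L[ℂ] H) (hT : IsSelfAdjoint T) {ε : ℝ}
    (hε : 0 < ε) (E : ℝ) (φ ψ : H) :
    inner ℂ φ (borelCalculus T (lorentzKernel ε E) ψ)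
      = ε * inner ℂ (Ring.inverse (T - (E + ε * Complex.I : ℂ) • ContinuousLinearMap.id ℂ H) φ)
        (Ring.inverse (T - (E + ε * Complex.I : ℂ) • ContinuousLinearMap.id ℂ H) ψ) := by
  have hz : (E + ε * Complex.I : ℂ).im ≠ 0 := by simpa using hε.ne'
  have hc := inv_sub_continuous hz
  have hb := norm_inv_sub_le hz
  have hcc : Continuous fun r : ℝ => (starRingEnd ℂ) ((r : ℂ) - (E + ε * Complex.I))⁻¹ :=
    Complex.continuous_conj.comp hc
  have hbc : ∀ r : ℝ, ‖(starRingEnd ℂ) ((r : ℂ) - (E + ε * Complex.I))⁻¹‖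
      ≤ |(E + ε * Complex.I : ℂ).im|⁻¹ := fun r => by
    rw [RCLike.norm_conj]
    exact hb r
  rw [inverse_eq_borelCalculus T hT hz, ← ContinuousLinearMap.adjoint_inner_right,
    adjoint_borelCalculus T hc.measurable hb, ← inner_smul_right]
  have : lorentzKernel ε E = fun r : ℝ => (ε : ℂ) *
      ((starRingEnd ℂ) ((r : ℂ) - (E + ε * Complex.I))⁻¹ * ((r : ℂ) - (E + ε * Complex.I))⁻¹) :=
    funext fun r => lorentzKernel_eq ε E r
  rw [this, borelCalculus_const_mul T (g := fun r : ℝ =>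
      (starRingEnd ℂ) ((r : ℂ) - (E + ε * Complex.I))⁻¹ * ((r : ℂ) - (E + ε * Complex.I))⁻¹)
      (hcc.mul hc).measurable
      (M := |(E + ε * Complex.I : ℂ).im|⁻¹ * |(E + ε * Complex.I : ℂ).im|⁻¹)
      (fun r => by
        rw [norm_mul]
        exact mul_le_mul (hbc r) (hb r) (norm_nonneg _) (by positivity)),
    borelCalculus_mul T hT hcc.measurable hc.measurable hbc hb]
  rfl

theorem measurable_poissonIntegral {f : ℝ → ℂ} (hf : Continuous f) {ε : ℝ} (hε : 0 < ε) :
    Measurable (poissonIntegral f ε) := by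
  have h : StronglyMeasurable fun p : ℝ × ℝ => f p.2 * lorentzKernel ε p.2 p.1 :=
    ((hf.comp continuous_snd).mul
      ((continuous_lorentzKernel hε).comp continuous_swap)).stronglyMeasurable
  exact (h.integral_prod_right (ν := volume)).measurable.const_mul _

/-- Fubini for each of the finitely many finite spectral measures of the polarization. Integrability
is automatic: the energies stay in a bounded interval and the kernel is at most `ε⁻¹`. -/
theorem inner_borelCalculus_poissonIntegral (T : H →L[ℂ] H) (hT : IsSelfAdjoint T) {f : ℝ → ℂ}
    (hf : Continuous f) (hM : ∀ r, ‖f r‖ ≤ 1) {a b : ℝ} (hI : ∀ r ∉ Set.Ioo a b, f r = 0)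
    {ε : ℝ} (hε : 0 < ε) (φ ψ : H) :
    inner ℂ φ (borelCalculus T (poissonIntegral f ε) ψ) = (Real.pi : ℂ)⁻¹ *
      ∫ E in Set.Ioo a b, f E * (ε * inner ℂ
        (Ring.inverse (T - (E + ε * Complex.I : ℂ) • ContinuousLinearMap.id ℂ H) φ)
        (Ring.inverse (T - (E + ε * Complex.I : ℂ) • ContinuousLinearMap.id ℂ H) ψ)) := by
  have hPm := measurable_poissonIntegral hf hε
  have hk : ∀ E, Measurable (lorentzKernel ε E) := fun E =>
    ((continuous_lorentzKernel hε).comp (Continuous.prodMk_right E)).measurable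
  simp_rw [← inner_borelCalculus_lorentzKernel T hT hε]
  rw [inner_borelCalculus T hPm (norm_poissonIntegral_le hM hε)]
  simp only [inner_borelCalculus T (hk _) (norm_lorentzKernel_le hε _)]
  simp only [Finsupp.linearCombination_apply, Finsupp.sum, smul_eq_mul]
  have hint := fun v => integrable_mul_lorentzKernel (spectralMeasure T v) hf hM hε a b
  have hswap : ∀ v, ∫ r, poissonIntegral f ε r ∂(spectralMeasure T v) = (Real.pi : ℂ)⁻¹ *
      ∫ E in Set.Ioo a b, ∫ r, f E * lorentzKernel ε E r ∂(spectralMeasure T v) := by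
    intro v
    simp only [poissonIntegral_eq_setIntegral hI]
    rw [integral_const_mul, integral_integral_swap
      (f := fun r E => f E * lorentzKernel ε E r) (hint v).swap]
  simp only [hswap]
  have hF : ∀ E, f E * ∑ v ∈ (polarization φ ψ).support, polarization φ ψ v *
      ∫ r, lorentzKernel ε E r ∂(spectralMeasure T v)
      = ∑ v ∈ (polarization φ ψ).support, polarization φ ψ v *
        ∫ r, f E * lorentzKernel ε E r ∂(spectralMeasure T v) := by
    intro E
    rw [Finset.mul_sum]
    refine Finset.sum_congr rfl fun v _ => ?_
    rw [integral_const_mul]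
    ring
  simp only [hF]
  rw [integral_finsetSum _ fun v _ => ((hint v).integral_prod_left).const_mul _, Finset.mul_sum]
  refine Finset.sum_congr rfl fun v _ => ?_
  rw [integral_const_mul]
  ring

/-- Matrix elements of functions of `T` with support in `(a, b)` are controlled by the resolvent
close to `(a, b)`. -/
theorem enorm_inner_borelCalculus_le_liminf (T : H →L[ℂ] H) (hT : IsSelfAdjoint T) {f : ℝ → ℂ}
    (hf : Continuous f) (hM : ∀ r, ‖f r‖ ≤ 1) {a b : ℝ} (hI : ∀ r ∉ Set.Ioo a b, f r = 0)
    {ε : ℕ → ℝ} (hε : ∀ n, 0 < ε n) (hε0 : Tendsto ε atTop (𝓝 0)) (φ ψ : H) :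
    ‖inner ℂ φ (borelCalculus T f ψ)‖ₑ ≤ liminf (fun n => ∫⁻ E in Set.Ioo a b,
      ‖ε n * inner ℂ
        (Ring.inverse (T - (E + ε n * Complex.I : ℂ) • ContinuousLinearMap.id ℂ H) φ)
        (Ring.inverse (T - (E + ε n * Complex.I : ℂ) • ContinuousLinearMap.id ℂ H) ψ)‖ₑ) atTop := by
  have hPm : ∀ n, Measurable (poissonIntegral f (ε n)) := fun n =>
    measurable_poissonIntegral hf (hε n)
  have t := tendsto_inner_borelCalculus T hPm hf.measurable
    (fun n => norm_poissonIntegral_le hM (hε n)) hM φ ψ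
    (fun v _ => Eventually.of_forall (tendsto_poissonIntegral hf hM hε hε0))
  rw [← ((continuous_enorm.tendsto _).comp t).liminf_eq]
  refine liminf_le_liminf (Eventually.of_forall fun n => ?_)
  rw [Function.comp_apply, inner_borelCalculus_poissonIntegral T hT hf hM hI (hε n), enorm_mul]
  -- The factor `π⁻¹` is simply dropped. With `|f| ≤ 1` this removes every trace of `f` from the
  -- bound.
  have h1 : ‖(Real.pi : ℂ)⁻¹‖ₑ ≤ 1 := by
    rw [← ofReal_norm, norm_inv, Complex.norm_real, Real.norm_of_nonneg Real.pi_pos.le]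
    exact ENNReal.ofReal_le_one.2 (inv_le_one_of_one_le₀ (by linarith [Real.pi_gt_three]))
  refine (mul_le_mul' h1 (enorm_integral_le_lintegral_enorm _)).trans ?_
  rw [one_mul]
  refine lintegral_mono fun E => ?_
  rw [enorm_mul]
  have h2 : ‖f E‖ₑ ≤ 1 := by
    rw [← ofReal_norm]
    exact ENNReal.ofReal_le_one.2 (hM E)
  exact (mul_le_mul' h2 le_rfl).trans (one_mul _).le
end Poisson

/-! ### Self-adjointness and norm bounds for the Anderson Hamiltonian. -/

section LatticeOperators

variable {d : ℕ}

theorem inner_basisVector_left (x : Fin d → ℤ) (u : LatticeL2 d) :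
    inner ℂ (basisVector x) u = u x := by
  rw [basisVector, lp.inner_single_left]
  simp

theorem basisVector_apply (x n : Fin d → ℤ) :
    basisVector x n = if n = x then 1 else 0 := by
  rw [basisVector, lp.single_apply, Pi.single_apply]

theorem norm_basisVector (x : Fin d → ℤ) : ‖basisVector x‖ = 1 := by
  rw [basisVector, lp.norm_single (by norm_num)]
  simp

theorem shift_apply (k : Fin d → ℤ) (u : LatticeL2 d) (n : Fin d → ℤ) :
    shift k u n = u (n + k) := rfl

theorem norm_shift_le (k : Fin d → ℤ) : ‖shift k‖ ≤ 1 :=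
  LinearMap.mkContinuous_norm_le _ zero_le_one _

theorem inner_shift_left (k : Fin d → ℤ) (u w : LatticeL2 d) :
    inner ℂ (shift k u) w = inner ℂ u (shift (-k) w) := by
  rw [lp.inner_eq_tsum, lp.inner_eq_tsum,
    ← (Equiv.addRight k).tsum_eq fun n => inner ℂ (u n) (shift (-k) w n)]
  simp [shift_apply]

theorem neg_mem_unitVectors {k : Fin d → ℤ} (hk : k ∈ unitVectors d) : -k ∈ unitVectors d := by
  rw [mem_unitVectors] at hk ⊢
  simpa using hk

theorem isSelfAdjoint_discreteLaplacian (d : ℕ) : IsSelfAdjoint (discreteLaplacian d) := by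
  rw [ContinuousLinearMap.isSelfAdjoint_iff_isSymmetric]
  intro u w
  simp only [discreteLaplacian, ContinuousLinearMap.coe_coe, neg_apply, _root_.sum_apply,
    inner_neg_left, inner_neg_right, sum_inner, inner_sum, inner_shift_left]
  congr 1
  exact Finset.sum_nbij' (fun k => -k) (fun k => -k) (fun k hk => neg_mem_unitVectors hk)
    (fun k hk => neg_mem_unitVectors hk) (by simp) (by simp) (by simp)

theorem isSelfAdjoint_potentialOperator (v : (Fin d → ℤ) → ℝ) :
    IsSelfAdjoint (potentialOperator v) := by
  by_cases h : ∃ K : ℝ, 0 ≤ K ∧ ∀ n, |v n| ≤ K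
  · obtain ⟨K, -, hK⟩ := h
    rw [ContinuousLinearMap.isSelfAdjoint_iff_isSymmetric]
    intro u w
    simp only [ContinuousLinearMap.coe_coe, lp.inner_eq_tsum, potentialOperator_apply v hK]
    refine tsum_congr fun n => ?_
    simp only [RCLike.inner_apply, map_mul, Complex.conj_ofReal]
    ring
  · rw [potentialOperator, dif_neg h]
    exact IsSelfAdjoint.zero _

theorem isSelfAdjoint_andersonHamiltonian (v : (Fin d → ℤ) → ℝ) :
    IsSelfAdjoint (andersonHamiltonian v) :=
  (isSelfAdjoint_discreteLaplacian d).add (isSelfAdjoint_potentialOperator v)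

theorem norm_discreteLaplacian_le (d : ℕ) : ‖discreteLaplacian d‖ ≤ (unitVectors d).card := by
  rw [discreteLaplacian, norm_neg]
  refine (norm_sum_le _ _).trans ((Finset.sum_le_sum fun k _ => norm_shift_le k).trans ?_)
  simp

theorem norm_potentialOperator_le {v : (Fin d → ℤ) → ℝ} {A : ℝ} (hA : 0 ≤ A)
    (hv : ∀ n, |v n| ≤ A) : ‖potentialOperator v‖ ≤ A := by
  have hT : ∀ n, ‖((v n : ℂ) • ContinuousLinearMap.id ℂ ℂ)‖ ≤ A := fun n => by
    rw [norm_smul, ContinuousLinearMap.norm_id, mul_one, Complex.norm_real]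
    exact hv n
  have : potentialOperator v = lp.mapCLM 2 (fun n => (v n : ℂ) • ContinuousLinearMap.id ℂ ℂ)
      hA hT := by
    ext u n
    rw [potentialOperator_apply v hv]
    simp
  rw [this]
  exact lp.norm_mapCLM_le _ _ _ _

theorem norm_andersonHamiltonian_le {v : (Fin d → ℤ) → ℝ} {A : ℝ} (hA : 0 ≤ A)
    (hv : ∀ n, |v n| ≤ A) : ‖andersonHamiltonian v‖ ≤ (unitVectors d).card + A :=
  norm_add_le_of_le (norm_discreteLaplacian_le d) (norm_potentialOperator_le hA hv)

theorem andersonHamiltonian_apply {v : (Fin d → ℤ) → ℝ} {A : ℝ} (hv : ∀ n, |v n| ≤ A)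
    (u : LatticeL2 d) (n : Fin d → ℤ) :
    andersonHamiltonian v u n = -∑ k ∈ unitVectors d, u (n + k) + v n * u n := by
  rw [← discreteLaplacian_apply, ← potentialOperator_apply v hv]
  rfl

end LatticeOperators

/-! ### Polynomial approximation, uniform over operators of bounded norm. -/

section PolynomialApproximation

variable {H : Type*} [NormedAddCommGroup H] [InnerProductSpace ℂ H] [CompleteSpace H]

theorem borelCalculus_ofReal_comp (a : H →L[ℂ] H) {f : ℝ → ℝ} (hf : Continuous f) {M : ℝ}
    (hM : ∀ r, |f r| ≤ M) : borelCalculus a (fun r => (f r : ℂ)) = cfc f a := by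
  rw [borelCalculus_eq_cfc_add_cfc a (f := fun r => (f r : ℂ)) (M := M)
    (Complex.continuous_ofReal.comp hf)
    (fun r => by rw [Complex.norm_real]; exact hM r)]
  have : cfc (fun r => ((f r : ℂ)).im) a = 0 := by
    simp only [Complex.ofReal_im]
    exact cfc_const_zero ℝ a
  rw [this]
  simp

/-- Uniform polynomial approximation of functions of self-adjoint operators of norm at most `K`. -/
theorem exists_polynomial_norm_aeval_sub_le {f : ℝ → ℝ} (hf : Continuous f) {M : ℝ}
    (hM : ∀ r, |f r| ≤ M) (K : ℝ) {δ : ℝ} (hδ : 0 < δ) :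
    ∃ p : Polynomial ℝ, ∀ a : H →L[ℂ] H, IsSelfAdjoint a → ‖a‖ ≤ K →
      ‖Polynomial.aeval a p - borelCalculus a (fun r => (f r : ℂ))‖ ≤ δ := by
  obtain ⟨p, hp⟩ := exists_polynomial_near_of_continuousOn (-K) K f hf.continuousOn δ hδ
  refine ⟨p, fun a ha hK => ?_⟩
  rw [borelCalculus_ofReal_comp a hf hM, ← cfc_polynomial (R := ℝ) p a ha,
    ← cfc_sub (R := ℝ) _ f _ p.continuous.continuousOn hf.continuousOn]
  exact norm_cfc_le hδ.le fun r hr =>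
    (hp r (abs_le.1 ((abs_le_norm_of_mem_spectrum a hr).trans hK))).le

end PolynomialApproximation

/-! ### Measurability in the random potential. -/

section Measurability

variable {d : ℕ} {α : Type*} [MeasurableSpace α] {w : α → (Fin d → ℤ) → ℝ} {A : ℝ}

/-- The operator has finite range, so each component of a power is a finite combination of
components of the previous power, with measurable coefficients. -/
theorem measurable_pow_andersonHamiltonian (hw : ∀ n, Measurable fun o => w o n)
    (hwA : ∀ o n, |w o n| ≤ A) (u : LatticeL2 d) (k : ℕ) (n : Fin d → ℤ) :
    Measurable fun o => (andersonHamiltonian (w o) ^ k) u n := by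
  induction k generalizing n with
  | zero => simp
  | succ k ih =>
    have : ∀ o, (andersonHamiltonian (w o) ^ (k + 1)) u n
        = -∑ j ∈ unitVectors d, (andersonHamiltonian (w o) ^ k) u (n + j)
          + w o n * (andersonHamiltonian (w o) ^ k) u n := fun o => by
      rw [pow_succ']
      exact andersonHamiltonian_apply (hwA o) _ n
    simp only [this]
    exact (Finset.measurable_sum _ fun j _ => ih (n + j)).neg.add
      ((Complex.measurable_ofReal.comp (hw n)).mul (ih n))

theorem measurable_aeval_andersonHamiltonian (hw : ∀ n, Measurable fun o => w o n)
    (hwA : ∀ o n, |w o n| ≤ A) (u : LatticeL2 d) (p : Polynomial ℝ) (n : Fin d → ℤ) :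
    Measurable fun o => Polynomial.aeval (andersonHamiltonian (w o)) p u n := by
  have : ∀ o, Polynomial.aeval (andersonHamiltonian (w o)) p u n
      = ∑ i ∈ Finset.range (p.natDegree + 1),
        (p.coeff i : ℂ) * (andersonHamiltonian (w o) ^ i) u n := fun o => by
    rw [Polynomial.aeval_eq_sum_range, _root_.sum_apply, lp.coeFn_sum, Finset.sum_apply]
    rfl
  simp only [this]
  exact Finset.measurable_sum _ fun i _ =>
    (measurable_pow_andersonHamiltonian hw hwA u i n).const_mul _

theorem lp_apply_sub_norm_le (S T : LatticeL2 d →L[ℂ] LatticeL2 d) (u : LatticeL2 d)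
    (n : Fin d → ℤ) : ‖S u n - T u n‖ ≤ ‖S - T‖ * ‖u‖ := by
  have h := lp.norm_apply_le_norm (p := 2) (by norm_num) ((S - T) u) n
  exact h.trans ((S - T).le_opNorm u)

/-- The norms of all `h` are at most the number of unit vectors plus `A`, so one sequence of
polynomials approximates the real part of `f(h)`, and one the imaginary part, for every realization
at once. -/
theorem measurable_borelCalculus_of_continuous (hA : 0 ≤ A) (hw : ∀ n, Measurable fun o => w o n)
    (hwA : ∀ o n, |w o n| ≤ A) {f : ℝ → ℂ} (hf : Continuous f) {M : ℝ} (hM : ∀ r, ‖f r‖ ≤ M)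
    (u : LatticeL2 d) (n : Fin d → ℤ) :
    Measurable fun o => borelCalculus (andersonHamiltonian (w o)) f u n := by
  have hre := Complex.continuous_re.comp hf
  have him := Complex.continuous_im.comp hf
  have hP : ∀ j : ℕ, (0 : ℝ) < 1 / ((j : ℝ) + 1) := fun j => by positivity
  choose p hp using fun j => exists_polynomial_norm_aeval_sub_le (H := LatticeL2 d) hre
    (fun r => (Complex.abs_re_le_norm _).trans (hM r)) ((unitVectors d).card + A) (hP j)
  choose q hq using fun j => exists_polynomial_norm_aeval_sub_le (H := LatticeL2 d) him
    (fun r => (Complex.abs_im_le_norm _).trans (hM r)) ((unitVectors d).card + A) (hP j)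
  refine measurable_of_tendsto_metrizable
    (fun j => (measurable_aeval_andersonHamiltonian hw hwA u (p j) n).add
      ((measurable_aeval_andersonHamiltonian hw hwA u (q j) n).const_mul Complex.I))
    (tendsto_pi_nhds.2 fun o => ?_)
  have hsa := isSelfAdjoint_andersonHamiltonian (w o)
  have hle := norm_andersonHamiltonian_le hA (hwA o)
  have hdecomp : borelCalculus (andersonHamiltonian (w o)) f u n
      = borelCalculus (andersonHamiltonian (w o)) (fun r => (((f r).re : ℝ) : ℂ)) u n
        + Complex.I * borelCalculus (andersonHamiltonian (w o))
          (fun r => (((f r).im : ℝ) : ℂ)) u n := by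
    have hbre : ∀ r, ‖(((f r).re : ℝ) : ℂ)‖ ≤ M := fun r => by
      rw [Complex.norm_real]
      exact (Complex.abs_re_le_norm _).trans (hM r)
    have hbim : ∀ r, ‖(((f r).im : ℝ) : ℂ)‖ ≤ M := fun r => by
      rw [Complex.norm_real]
      exact (Complex.abs_im_le_norm _).trans (hM r)
    have hmre := Complex.measurable_ofReal.comp hre.measurable
    have hmim := Complex.measurable_ofReal.comp him.measurable
    have h1 := borelCalculus_add (andersonHamiltonian (w o)) hmre (hmim.const_mul Complex.I) hbre
      (N := M) (fun r => by rw [norm_mul, Complex.norm_I, one_mul]; exact hbim r)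
    have h2 := borelCalculus_const_mul (andersonHamiltonian (w o)) hmim hbim Complex.I
    have h3 : f = fun r => (((f r).re : ℝ) : ℂ) + Complex.I * (((f r).im : ℝ) : ℂ) := by
      ext r
      rw [mul_comm]
      exact (Complex.re_add_im _).symm
    conv_lhs => rw [h3]
    refine (congrArg (fun T : LatticeL2 d →L[ℂ] LatticeL2 d => T u n) h1).trans ?_
    exact congrArg₂ (fun s t : ℂ => s + t) rfl
      (congrArg (fun T : LatticeL2 d →L[ℂ] LatticeL2 d => T u n) h2)
  rw [hdecomp]
  have key : ∀ (T : ℕ → LatticeL2 d →L[ℂ] LatticeL2 d) (S : LatticeL2 d →L[ℂ] LatticeL2 d),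
      (∀ j, ‖T j - S‖ ≤ 1 / ((j : ℝ) + 1)) →
      Tendsto (fun j => T j u n) atTop (𝓝 (S u n)) := by
    intro T S hTS
    rw [tendsto_iff_norm_sub_tendsto_zero]
    refine squeeze_zero (fun _ => norm_nonneg _) (fun j => ?_)
      (g := fun j : ℕ => 1 / ((j : ℝ) + 1) * ‖u‖)
      (by simpa using (tendsto_one_div_add_atTop_nhds_zero_nat (𝕜 := ℝ)).mul_const ‖u‖)
    exact (lp_apply_sub_norm_le _ _ u n).trans
      (mul_le_mul_of_nonneg_right (hTS j) (norm_nonneg u))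
  exact (key _ _ fun j => hp j _ hsa hle).add ((key _ _ fun j => hq j _ hsa hle).const_mul _)

/-- Continuous cutoff functions that increase to the indicator of `(a, b)`. -/
def intervalCutoff (a b : ℝ) (j : ℕ) (r : ℝ) : ℝ := max 0 (min 1 (j * min (r - a) (b - r)))

theorem continuous_intervalCutoff (a b : ℝ) (j : ℕ) : Continuous (intervalCutoff a b j) := by
  unfold intervalCutoff
  fun_prop

theorem intervalCutoff_mem_Icc (a b : ℝ) (j : ℕ) (r : ℝ) :
    intervalCutoff a b j r ∈ Set.Icc (0 : ℝ) 1 :=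
  ⟨le_max_left _ _, max_le zero_le_one (min_le_left _ _)⟩

theorem norm_intervalCutoff_le (a b : ℝ) (j : ℕ) (r : ℝ) :
    ‖(intervalCutoff a b j r : ℂ)‖ ≤ 1 := by
  have h := intervalCutoff_mem_Icc a b j r
  rw [Complex.norm_real, Real.norm_of_nonneg h.1]
  exact h.2

theorem intervalCutoff_eq_zero {a b r : ℝ} (hr : r ∉ Set.Ioo a b) (j : ℕ) :
    intervalCutoff a b j r = 0 := by
  have : min (r - a) (b - r) ≤ 0 := by
    rw [Set.mem_Ioo, not_and_or, not_lt, not_lt] at hr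
    rcases hr with h | h
    · exact (min_le_left _ _).trans (by linarith)
    · exact (min_le_right _ _).trans (by linarith)
  exact max_eq_left ((min_le_right _ _).trans (mul_nonpos_of_nonneg_of_nonpos (by positivity) this))

theorem tendsto_intervalCutoff (a b r : ℝ) :
    Tendsto (fun j => (intervalCutoff a b j r : ℂ)) atTop (𝓝 ((Set.Ioo a b).indicator 1 r)) := by
  by_cases hr : r ∈ Set.Ioo a b
  · have hpos : 0 < min (r - a) (b - r) := lt_min (by linarith [hr.1]) (by linarith [hr.2])
    refine tendsto_const_nhds.congr' ?_
    obtain ⟨N, hN⟩ := exists_nat_gt (1 / min (r - a) (b - r))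
    filter_upwards [eventually_ge_atTop N] with j hj
    have h1 : 1 ≤ (j : ℝ) * min (r - a) (b - r) := by
      rw [← div_le_iff₀ hpos]
      exact hN.le.trans (by exact_mod_cast hj)
    simp [intervalCutoff, hr, min_eq_left h1]
  · simp [intervalCutoff_eq_zero hr, hr]

theorem norm_mul_indicator_le {g : ℝ → ℂ} {M : ℝ} (hM : ∀ r, ‖g r‖ ≤ M) (I : Set ℝ) (r : ℝ) :
    ‖g r * I.indicator 1 r‖ ≤ M := by
  rw [norm_mul]
  exact (mul_le_of_le_one_right (norm_nonneg _) (norm_indicator_one_le I r)).trans (hM r)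

theorem norm_mul_intervalCutoff_le {g : ℝ → ℂ} {M : ℝ} (hM : ∀ r, ‖g r‖ ≤ M) (a b : ℝ) (j : ℕ)
    (r : ℝ) : ‖g r * intervalCutoff a b j r‖ ≤ M := by
  rw [norm_mul]
  exact (mul_le_of_le_one_right (norm_nonneg _) (norm_intervalCutoff_le a b j r)).trans (hM r)

theorem measurable_inner_borelCalculus_indicator (hA : 0 ≤ A)
    (hw : ∀ n, Measurable fun o => w o n)
    (hwA : ∀ o n, |w o n| ≤ A) {g : ℝ → ℂ} (hg : Continuous g) {M : ℝ} (hM : ∀ r, ‖g r‖ ≤ M)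
    (a b : ℝ) (x : Fin d → ℤ) (u : LatticeL2 d) :
    Measurable fun o => inner ℂ (basisVector x) (borelCalculus (andersonHamiltonian (w o))
      (fun r => g r * (Set.Ioo a b).indicator 1 r) u) := by
  have hc : ∀ j, Continuous fun r => g r * intervalCutoff a b j r := fun j =>
    hg.mul (Complex.continuous_ofReal.comp (continuous_intervalCutoff a b j))
  refine measurable_of_tendsto_metrizable (f := fun j o => inner ℂ (basisVector x)
    (borelCalculus (andersonHamiltonian (w o)) (fun r => g r * intervalCutoff a b j r) u))
    (fun j => ?_) (tendsto_pi_nhds.2 fun o => ?_)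
  · simp only [inner_basisVector_left]
    exact measurable_borelCalculus_of_continuous hA hw hwA (hc j)
      (norm_mul_intervalCutoff_le hM a b j) u x
  · exact tendsto_inner_borelCalculus _ (fun j => (hc j).measurable)
      (hg.measurable.mul (measurable_one.indicator measurableSet_Ioo))
      (norm_mul_intervalCutoff_le hM a b) (norm_mul_indicator_le hM _) _ _
      fun v _ => Eventually.of_forall fun r => (tendsto_intervalCutoff a b r).const_mul _

theorem greenFunction_eq (v : (Fin d → ℤ) → ℝ) (x y : Fin d → ℤ) {z : ℂ} (hz : z.im ≠ 0) :
    greenFunction v x y z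
      = inner ℂ (basisVector x) (borelCalculus (andersonHamiltonian v)
        (fun r => ((r : ℂ) - z)⁻¹) (basisVector y)) := by
  rw [greenFunction, inverse_eq_borelCalculus _ (isSelfAdjoint_andersonHamiltonian v) hz]

theorem measurable_greenFunction (hA : 0 ≤ A) (hw : ∀ n, Measurable fun o => w o n)
    (hwA : ∀ o n, |w o n| ≤ A) (x y : Fin d → ℤ) {z : ℂ} (hz : z.im ≠ 0) :
    Measurable fun o => greenFunction (w o) x y z := by
  simp only [greenFunction_eq _ _ _ hz, inner_basisVector_left]
  exact measurable_borelCalculus_of_continuous hA hw hwA (inv_sub_continuous hz)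
    (norm_inv_sub_le hz) _ _

theorem im_add_mul_I_ne_zero {ε : ℝ} (hε : 0 < ε) (E : ℝ) : (E + ε * Complex.I : ℂ).im ≠ 0 := by
  simpa using hε.ne'

theorem continuous_greenFunction (v : (Fin d → ℤ) → ℝ) (x y : Fin d → ℤ) {ε : ℝ} (hε : 0 < ε) :
    Continuous fun E : ℝ => greenFunction v x y (E + ε * Complex.I) := by
  refine continuous_iff_seqContinuous.2 fun E E₀ hE => ?_
  simp only [Function.comp_def, greenFunction_eq _ _ _ (im_add_mul_I_ne_zero hε _)]
  have hb : ∀ (E r : ℝ), ‖((r : ℂ) - (E + ε * Complex.I))⁻¹‖ ≤ ε⁻¹ := fun E r => by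
    have := norm_inv_sub_le (im_add_mul_I_ne_zero hε E) r
    simpa [abs_of_pos hε] using this
  refine tendsto_inner_borelCalculus _
    (fun n => (inv_sub_continuous (im_add_mul_I_ne_zero hε (E n))).measurable)
    (inv_sub_continuous (im_add_mul_I_ne_zero hε E₀)).measurable (fun n => hb (E n)) (hb E₀) _ _
    fun v _ => Eventually.of_forall fun r => Tendsto.inv₀ ?_ ?_
  · exact (((Complex.continuous_ofReal.tendsto _).comp hE).add_const _).const_sub _
  · intro h
    have := congrArg Complex.im h
    simp [hε.ne'] at this

/-- Joint measurability, as needed for Tonelli: the function is continuous in the energy and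
measurable in the randomness. -/
theorem measurable_uncurry_greenFunction (hA : 0 ≤ A) (hw : ∀ n, Measurable fun o => w o n)
    (hwA : ∀ o n, |w o n| ≤ A) (x y : Fin d → ℤ) {ε : ℝ} (hε : 0 < ε) :
    Measurable (Function.uncurry fun (E : ℝ) o => greenFunction (w o) x y (E + ε * Complex.I)) :=
  measurable_uncurry_of_continuous_of_measurable
    (fun o => continuous_greenFunction (w o) x y hε)
    (fun E => measurable_greenFunction hA hw hwA x y (im_add_mul_I_ne_zero hε E))

theorem timeSupremum_eq (v : (Fin d → ℤ) → ℝ) {I : Set ℝ} (hI : MeasurableSet I)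
    (x y : Fin d → ℤ) : timeSupremum v I x y = ⨆ t : ℝ, ‖inner ℂ (basisVector x)
      (borelCalculus (andersonHamiltonian v)
        (fun r => Complex.exp (-Complex.I * t * r) * I.indicator 1 r) (basisVector y))‖ₑ := by
  have h : ∀ t r : ℝ, ‖Complex.exp (-Complex.I * t * r)‖ ≤ 1 := fun t r => by
    simp [Complex.norm_exp]
  refine iSup_congr fun t => ?_
  rw [borelCalculus_mul_spectralProjection _ (isSelfAdjoint_andersonHamiltonian v)
    (by fun_prop) (h t) hI]

theorem timeSupremum_le_borelSupremum (v : (Fin d → ℤ) → ℝ) (I : Set ℝ)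
    (x y : Fin d → ℤ) : timeSupremum v I x y ≤ borelSupremum v I x y :=
  iSup_le fun t => le_iSup (fun g : {g : ℝ → ℂ // Measurable g ∧ ∀ r, ‖g r‖ ≤ 1} =>
    ‖inner ℂ (basisVector x) (borelCalculus (andersonHamiltonian v) g
      (spectralProjection (andersonHamiltonian v) I (basisVector y)))‖ₑ)
    ⟨fun r => Complex.exp (-Complex.I * t * r), by fun_prop, fun r => by simp [Complex.norm_exp]⟩

theorem spectralVariation_eq_borelSupremum (v : (Fin d → ℤ) → ℝ) {I : Set ℝ}
    (hI : MeasurableSet I) (x y : Fin d → ℤ) :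
    spectralVariation v I x y = borelSupremum v I x y :=
  variation_mixedSpectralMeasure _ (isSelfAdjoint_andersonHamiltonian v) _ _ hI

theorem measurable_timeSupremum (hA : 0 ≤ A) (hw : ∀ n, Measurable fun o => w o n)
    (hwA : ∀ o n, |w o n| ≤ A) (a b : ℝ) (x y : Fin d → ℤ) :
    Measurable fun o => timeSupremum (w o) (Set.Ioo a b) x y := by
  have h : ∀ t r : ℝ, ‖Complex.exp (-Complex.I * t * r)‖ ≤ 1 := fun t r => by
    simp [Complex.norm_exp]
  have hc : ∀ t : ℝ, Continuous fun r : ℝ => Complex.exp (-Complex.I * t * r) := fun t => by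
    fun_prop
  have hχ : Measurable ((Set.Ioo a b).indicator (1 : ℝ → ℂ)) :=
    measurable_one.indicator measurableSet_Ioo
  let F : α → ℝ → ℂ := fun o t => inner ℂ (basisVector x)
    (borelCalculus (andersonHamiltonian (w o))
      (fun r => Complex.exp (-Complex.I * t * r) * (Set.Ioo a b).indicator 1 r) (basisVector y))
  have hF : ∀ o, Continuous (F o) := fun o => by
    refine continuous_iff_seqContinuous.2 fun t t₀ ht => ?_
    refine tendsto_inner_borelCalculus _ (fun n => (hc (t n)).measurable.mul hχ)
      ((hc t₀).measurable.mul hχ) (fun n => norm_mul_indicator_le (h (t n)) _)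
      (norm_mul_indicator_le (h t₀) _) _ _ fun v _ => Eventually.of_forall fun r => ?_
    have hcont : Continuous fun t : ℝ => Complex.exp (-Complex.I * t * r) := by fun_prop
    exact ((hcont.tendsto t₀).comp ht).mul_const _
  have e : ∀ o, timeSupremum (w o) (Set.Ioo a b) x y = ⨆ q : ℚ, ‖F o q‖ₑ := fun o => by
    rw [timeSupremum_eq _ measurableSet_Ioo]
    refine le_antisymm (iSup_le fun t => ?_) (iSup_le fun q => le_iSup (fun t : ℝ => ‖F o t‖ₑ) q)
    refine Rat.denseRange_cast.induction_on (p := fun t : ℝ => ‖F o t‖ₑ ≤ ⨆ q : ℚ, ‖F o q‖ₑ) t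
      (isClosed_le (hF o).enorm continuous_const) fun q => le_iSup (fun q : ℚ => ‖F o q‖ₑ) q
  simp only [e]
  exact Measurable.iSup fun q =>
    (measurable_inner_borelCalculus_indicator hA hw hwA (hc q) (h q) a b x _).enorm

/-- Borel functions do not form a separable family in the sup norm. Each matrix element, however, is
a limit of those of continuous functions, and only their restrictions to `[-K, K]` matter, where `K`
bounds all operator norms. The unit ball of `C([-K, K])` is separable, so one countable family
serves every realization. -/
theorem measurable_borelSupremum (hA : 0 ≤ A) (hw : ∀ n, Measurable fun o => w o n)
    (hwA : ∀ o n, |w o n| ≤ A) (a b : ℝ) (x y : Fin d → ℤ) :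
    Measurable fun o => borelSupremum (w o) (Set.Ioo a b) x y := by
  let K : ℝ := (unitVectors d).card + A
  have hK : -K ≤ K := by
    have : 0 ≤ K := by positivity
    linarith
  let B := {q : C(Set.Icc (-K) K, ℂ) // ‖q‖ ≤ 1}
  have : Nonempty B := ⟨⟨0, by simp⟩⟩
  let ext : B → ℝ → ℂ := fun q r => q.1 (Set.projIcc (-K) K hK r)
  have hextc : ∀ q, Continuous (ext q) := fun q => q.1.continuous.comp continuous_projIcc
  have hextb : ∀ q r, ‖ext q r‖ ≤ 1 := fun q r => (q.1.norm_coe_le_norm _).trans q.2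
  have hχ : Measurable ((Set.Ioo a b).indicator (1 : ℝ → ℂ)) :=
    measurable_one.indicator measurableSet_Ioo
  let F : α → (ℝ → ℂ) → ℂ := fun o g => inner ℂ (basisVector x)
    (borelCalculus (andersonHamiltonian (w o))
      (fun r => g r * (Set.Ioo a b).indicator 1 r) (basisVector y))
  have e : ∀ o, borelSupremum (w o) (Set.Ioo a b) x y
      = ⨆ i : ℕ, ‖F o (ext (TopologicalSpace.denseSeq B i))‖ₑ := fun o => by
    have hsa := isSelfAdjoint_andersonHamiltonian (w o)
    refine le_antisymm (iSup_le fun g => ?_) (iSup_le fun i => ?_)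
    · rw [borelCalculus_mul_spectralProjection _ hsa g.2.1 g.2.2 measurableSet_Ioo]
      change ‖F o g‖ₑ ≤ _
      have hcont : Continuous fun q : B => F o (ext q) := by
        refine continuous_iff_seqContinuous.2 fun q q₀ hq => ?_
        refine tendsto_inner_borelCalculus _ (fun n => (hextc (q n)).measurable.mul hχ)
          ((hextc q₀).measurable.mul hχ) (fun n => norm_mul_indicator_le (hextb (q n)) _)
          (norm_mul_indicator_le (hextb q₀) _) _ _ fun v _ => Eventually.of_forall fun r => ?_
        have hev : Continuous fun q : B => ext q r :=
          (continuous_eval_const _).comp continuous_subtype_val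
        exact ((hev.tendsto q₀).comp hq).mul_const _
      have hq : ∀ q : B, ‖F o (ext q)‖ₑ
          ≤ ⨆ i : ℕ, ‖F o (ext (TopologicalSpace.denseSeq B i))‖ₑ := fun q => by
        refine (TopologicalSpace.denseRange_denseSeq B).induction_on
          (p := fun q => ‖F o (ext q)‖ₑ ≤ _) q (isClosed_le hcont.enorm continuous_const) fun i =>
          le_iSup (fun i : ℕ => ‖F o (ext (TopologicalSpace.denseSeq B i))‖ₑ) i
      -- This sequence depends on the realization, which is harmless: it only shows that continuous
      -- functions already attain the supremum.
      obtain ⟨f, h1, h2, h3⟩ := exists_continuous_seq_tendsto_ae_spectralMeasure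
        (andersonHamiltonian (w o)) (polarization (basisVector x) (basisVector y)).support
        g.2.1 g.2.2
      have t := tendsto_inner_borelCalculus (andersonHamiltonian (w o))
        (fun n => (h1 n).measurable.mul hχ) (g.2.1.mul hχ)
        (fun n => norm_mul_indicator_le (h2 n) _) (norm_mul_indicator_le g.2.2 _)
        (basisVector x) (basisVector y) fun v hv => by
          filter_upwards [h3 v hv] with r hr using hr.mul_const _
      refine le_of_tendsto ((continuous_enorm.tendsto _).comp t) (Eventually.of_forall fun n => ?_)
      let q : B := ⟨⟨fun r => f n r, (h1 n).comp continuous_subtype_val⟩,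
        (ContinuousMap.norm_le _ zero_le_one).2 fun r => h2 n r⟩
      refine le_trans (le_of_eq ?_) (hq q)
      have : borelCalculus (andersonHamiltonian (w o))
            (fun r => f n r * (Set.Ioo a b).indicator 1 r)
          = borelCalculus (andersonHamiltonian (w o))
            (fun r => ext q r * (Set.Ioo a b).indicator 1 r) := by
        refine borelCalculus_congr_of_abs_le_norm _ ((h1 n).measurable.mul hχ)
          ((hextc q).measurable.mul hχ) (norm_mul_indicator_le (h2 n) _)
          (norm_mul_indicator_le (hextb q) _) fun r hr => ?_
        have hr' : r ∈ Set.Icc (-K) K :=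
          abs_le.1 (hr.trans (norm_andersonHamiltonian_le hA (hwA o)))
        have : ext q r = f n r := by
          change f n (Set.projIcc (-K) K hK r) = f n r
          rw [Set.projIcc_of_mem hK hr']
        rw [this]
      change ‖inner ℂ _ (borelCalculus _ (fun r => f n r * (Set.Ioo a b).indicator 1 r) _)‖ₑ = _
      rw [this]
    · have := borelCalculus_mul_spectralProjection (andersonHamiltonian (w o)) hsa
        (hextc (TopologicalSpace.denseSeq B i)).measurable
        (hextb (TopologicalSpace.denseSeq B i)) (measurableSet_Ioo (a := a) (b := b))
        (basisVector y)
      refine le_trans (le_of_eq ?_) (le_iSup _ ⟨ext (TopologicalSpace.denseSeq B i),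
        (hextc _).measurable, hextb _⟩)
      change _ = ‖inner ℂ _ (borelCalculus _ (ext (TopologicalSpace.denseSeq B i)) _)‖ₑ
      rw [this]
  simp only [e]
  exact Measurable.iSup fun i =>
    (measurable_inner_borelCalculus_indicator hA hw hwA (hextc _) (hextb _) a b x _).enorm

end Measurability

/-! ### The Ward identity and rank-one perturbations. -/

section RankOne

variable {H : Type*} [NormedAddCommGroup H] [InnerProductSpace ℂ H] [CompleteSpace H]

theorem sub_smul_id_mul_inverse (T : H →L[ℂ] H) (hT : IsSelfAdjoint T) {z : ℂ} (hz : z.im ≠ 0) :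
    (T - z • ContinuousLinearMap.id ℂ H) * Ring.inverse (T - z • ContinuousLinearMap.id ℂ H)
      = 1 := by
  rw [inverse_eq_borelCalculus T hT hz]
  exact (borelCalculus_resolvent T hT hz).1

theorem inverse_mul_sub_smul_id (T : H →L[ℂ] H) (hT : IsSelfAdjoint T) {z : ℂ} (hz : z.im ≠ 0) :
    Ring.inverse (T - z • ContinuousLinearMap.id ℂ H) * (T - z • ContinuousLinearMap.id ℂ H)
      = 1 := by
  rw [inverse_eq_borelCalculus T hT hz]
  exact (borelCalculus_resolvent T hT hz).2

/-- The Ward identity `Im ⟨e, (T - z)⁻¹ e⟩ = Im z ‖(T - z)⁻¹ e‖²`. -/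
theorem im_inner_inverse_self (T : H →L[ℂ] H) (hT : IsSelfAdjoint T) {z : ℂ} (hz : z.im ≠ 0)
    (e : H) : (inner ℂ e (Ring.inverse (T - z • ContinuousLinearMap.id ℂ H) e)).im
      = z.im * ‖Ring.inverse (T - z • ContinuousLinearMap.id ℂ H) e‖ ^ 2 := by
  set u := Ring.inverse (T - z • ContinuousLinearMap.id ℂ H) e with hu
  have h1 : T u - z • u = e :=
    congrArg (fun S : H →L[ℂ] H => S e) (sub_smul_id_mul_inverse T hT hz)
  have h2 : (inner ℂ (T u) u).im = 0 := by
    have := hT.isSymmetric.coe_re_inner_apply_self u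
    exact (congrArg Complex.im this).symm
  have h3 : inner ℂ e u = inner ℂ (T u) u - (starRingEnd ℂ) z * ((‖u‖ ^ 2 : ℝ) : ℂ) := by
    conv_lhs => rw [← h1]
    rw [inner_sub_left, inner_smul_left, inner_self_eq_norm_sq_to_K]
    push_cast
    rfl
  rw [h3, Complex.sub_im, h2, Complex.im_mul_ofReal, Complex.conj_im]
  ring

/-- With `u = (T - z)⁻¹ e`, the vector `(T' - z) u` is again a multiple of `e`; applying the
resolvent of `T'` gives the formula. -/
theorem inverse_rankOne_apply (T T' : H →L[ℂ] H) (hT : IsSelfAdjoint T) (hT' : IsSelfAdjoint T')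
    {z : ℂ} (hz : z.im ≠ 0) (e : H) (c : ℂ) (h : ∀ u, T' u = T u + (c * inner ℂ e u) • e) :
    Ring.inverse (T - z • ContinuousLinearMap.id ℂ H) e
      = (1 + c * inner ℂ e (Ring.inverse (T - z • ContinuousLinearMap.id ℂ H) e)) •
        Ring.inverse (T' - z • ContinuousLinearMap.id ℂ H) e := by
  set u := Ring.inverse (T - z • ContinuousLinearMap.id ℂ H) e with hu
  have h1 : T u - z • u = e :=
    congrArg (fun S : H →L[ℂ] H => S e) (sub_smul_id_mul_inverse T hT hz)
  have h2 : Ring.inverse (T' - z • ContinuousLinearMap.id ℂ H) (T' u - z • u) = u :=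
    congrArg (fun S : H →L[ℂ] H => S u) (inverse_mul_sub_smul_id T' hT' hz)
  have h3 : T' u - z • u = (1 + c * inner ℂ e u) • e := by
    rw [h, add_sub_right_comm, h1, add_smul, one_smul]
  rw [← map_smul, ← h3, h2]

end RankOne

/-! ### The Green function as a function of one potential value. -/

section GreenFunction

variable {d : ℕ}

theorem andersonHamiltonian_update_apply {v : (Fin d → ℤ) → ℝ} {A : ℝ} (hA : 0 ≤ A)
    (hv : ∀ n, |v n| ≤ A) (x : Fin d → ℤ) {t : ℝ} (ht : |t| ≤ A) (u : LatticeL2 d) :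
    andersonHamiltonian (Function.update v x t) u
      = andersonHamiltonian (Function.update v x 0) u
        + ((t : ℂ) * inner ℂ (basisVector x) u) • basisVector x := by
  have hb : ∀ s : ℝ, |s| ≤ A → ∀ n, |Function.update v x s n| ≤ A := fun s hs n => by
    rcases eq_or_ne n x with rfl | hn
    · simpa using hs
    · simpa [hn] using hv n
  ext n
  rw [lp.coeFn_add, lp.coeFn_smul, Pi.add_apply, Pi.smul_apply, basisVector_apply,
    inner_basisVector_left, andersonHamiltonian_apply (hb t ht),
    andersonHamiltonian_apply (hb 0 (by simpa using hA))]
  rcases eq_or_ne n x with rfl | hn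
  · simp
  · simp [hn]

/-- The dependence of the Green function on the potential at one site. -/
theorem exists_greenFunction_update {v : (Fin d → ℤ) → ℝ} {A : ℝ} (hA : 0 ≤ A)
    (hv : ∀ n, |v n| ≤ A) (n x : Fin d → ℤ) {z : ℂ} (hz : 0 < z.im) :
    ∃ (w : ℂ) (R : ℝ), 0 ≤ R ∧ z.im ≤ w.im ∧ z.im * R ^ 2 ≤ w.im ∧
      ∀ t : ℝ, |t| ≤ A → ‖greenFunction (Function.update v x t) n x z‖ = R / ‖(t : ℂ) - w‖ := by
  set T := andersonHamiltonian (Function.update v x 0)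
  have hT : IsSelfAdjoint T := isSelfAdjoint_andersonHamiltonian _
  set u := Ring.inverse (T - z • ContinuousLinearMap.id ℂ (LatticeL2 d)) (basisVector x) with hu
  have hward := im_inner_inverse_self T hT hz.ne' (basisVector x)
  rw [← hu, inner_basisVector_left] at hward
  have hu0 : u ≠ 0 := by
    intro h0
    have h1 : T u - z • u = basisVector x :=
      congrArg (fun S : LatticeL2 d →L[ℂ] LatticeL2 d => S (basisVector x))
        (sub_smul_id_mul_inverse T hT hz.ne')
    have h2 := norm_basisVector x
    rw [← h1, h0] at h2
    simp at h2
  have hupos : 0 < ‖u‖ := norm_pos_iff.2 hu0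
  have hG : u x ≠ 0 := by
    intro h0
    rw [h0] at hward
    have : 0 < z.im * ‖u‖ ^ 2 := by positivity
    simp at hward
    rcases hward with h | h
    · exact hz.ne' h
    · exact hu0 h
  have hGpos : 0 < ‖u x‖ := norm_pos_iff.2 hG
  have hwim : (-(u x)⁻¹).im = z.im * ‖u‖ ^ 2 / ‖u x‖ ^ 2 := by
    rw [Complex.neg_im, Complex.inv_im, hward, Complex.normSq_eq_norm_sq]
    ring
  have hle : ∀ k, ‖u k‖ ≤ ‖u‖ := fun k => lp.norm_apply_le_norm (by norm_num) u k
  -- Here `u` is the column at `x` for zero potential at `x`, so that `G(n,x) = u n / (1 + t u x)`.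
  -- By the Ward identity `Im w = Im z ‖u‖² / |u x|²`, and both lower bounds follow since every
  -- component of `u` is at most `‖u‖`.
  refine ⟨-(u x)⁻¹, ‖u n‖ / ‖u x‖, by positivity, ?_, ?_, fun t ht => ?_⟩
  · rw [hwim, le_div_iff₀ (by positivity)]
    gcongr
    exact hle x
  · rw [hwim, div_pow, mul_div_assoc]
    gcongr
    exact hle n
  · have h := inverse_rankOne_apply T (andersonHamiltonian (Function.update v x t)) hT
      (isSelfAdjoint_andersonHamiltonian _) hz.ne' (basisVector x) t
      (andersonHamiltonian_update_apply hA hv x ht)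
    rw [← hu, inner_basisVector_left] at h
    have hn : u n = (1 + t * u x) * greenFunction (Function.update v x t) n x z := by
      rw [greenFunction, inner_basisVector_left]
      conv_lhs => rw [h]
      rfl
    have hne : (t : ℂ) - -(u x)⁻¹ ≠ 0 := by
      intro h0
      have := congrArg Complex.im h0
      rw [Complex.sub_im, hwim, Complex.ofReal_im, Complex.zero_im] at this
      have : 0 < z.im * ‖u‖ ^ 2 / ‖u x‖ ^ 2 := by positivity
      linarith
    have hfac : 1 + t * u x = u x * (t - -(u x)⁻¹) := by
      field_simp
      ring
    rw [hn, hfac, norm_mul, norm_mul]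
    have : 0 < ‖(t : ℂ) - -(u x)⁻¹‖ := norm_pos_iff.2 hne
    generalize ‖(t : ℂ) - -(u x)⁻¹‖ = q at this ⊢
    field_simp

end GreenFunction

/-! ### Averaging over one potential value. -/

section SingleSiteAverage

theorem lintegral_inv_norm_sub_sq (w : ℂ) (hw : 0 < w.im) (c : ℝ) (hc : 0 ≤ c) :
    ∫⁻ t : ℝ, ENNReal.ofReal (c / ‖(t : ℂ) - w‖ ^ 2) = ENNReal.ofReal (c * (Real.pi / w.im)) := by
  have h1 := lintegral_cauchyPDF_eq_one w.re (γ := w.im.toNNReal) (by simpa using hw)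
  have h2 : ∀ t : ℝ, ENNReal.ofReal (c / ‖(t : ℂ) - w‖ ^ 2)
      = ENNReal.ofReal (c * (Real.pi / w.im)) * cauchyPDF w.re w.im.toNNReal t := by
    intro t
    rw [cauchyPDF_def, cauchyPDFReal_def, Real.coe_toNNReal _ hw.le,
      ← ENNReal.ofReal_mul (by positivity)]
    congr 1
    have : ‖(t : ℂ) - w‖ ^ 2 = (t - w.re) ^ 2 + w.im ^ 2 := by
      rw [← Complex.normSq_eq_norm_sq, Complex.normSq_apply]
      simp
      ring
    rw [this]
    have hp := Real.pi_pos
    field_simp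
  simp only [h2]
  rw [lintegral_const_mul _ (measurable_cauchyPDF _ _), h1, mul_one]

/-- For `0 ≤ s ≤ 2` the power `t ^ s` lies between `1` and `t ^ 2`. This trades the second moment
for the fractional one. -/
theorem le_rpow_of_le_one_of_le_sq {q t s : ℝ} (hs0 : 0 ≤ s) (hs2 : s ≤ 2) (ht : 0 ≤ t)
    (hq1 : q ≤ 1) (hqt : q ≤ t ^ 2) : q ≤ t ^ s := by
  rcases le_total 1 t with h | h
  · exact hq1.trans (Real.one_le_rpow h hs0)
  · refine hqt.trans ?_
    rw [← Real.rpow_two]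
    rcases ht.eq_or_lt with rfl | ht'
    · rcases hs0.eq_or_lt with rfl | hs0'
      · simp
      · rw [Real.zero_rpow (by norm_num)]
        positivity
    · exact Real.rpow_le_rpow_of_exponent_ge ht' h hs2

/-- The average over a single-site potential bounds the second moment by fractional moments. -/
theorem lintegral_sq_le_lintegral_rpow {ρ : ℝ → ℝ} (hρ : Measurable ρ) {M : ℝ} (hM : ∀ v, ρ v ≤ M)
    (ν : Measure ℝ) [IsProbabilityMeasure ν]
    (hν : ν = volume.withDensity fun v => ENNReal.ofReal (ρ v)) {A : ℝ} (hA : 1 ≤ A)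
    (hνA : ∀ᵐ t ∂ν, |t| ≤ A) {s : ℝ} (hs : s ∈ Set.Ioo (0 : ℝ) 1) {ε : ℝ} (hε : 0 < ε) (hε1 : ε ≤ 1)
    {w : ℂ} {R : ℝ} (hR : 0 ≤ R) (hw : ε ≤ w.im) (hRw : ε * R ^ 2 ≤ w.im) :
    ∫⁻ t, ENNReal.ofReal (ε * (R / ‖(t : ℂ) - w‖) ^ 2) ∂ν
      ≤ ENNReal.ofReal (|M| * Real.pi * (3 * A) + 8)
        * ∫⁻ t, ENNReal.ofReal ((R / ‖(t : ℂ) - w‖) ^ s) ∂ν := by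
  obtain ⟨hs0, hs1⟩ := hs
  have hw0 : 0 < w.im := hε.trans_le hw
  have hpi := Real.pi_pos
  have hwpos : 0 < ‖w‖ := hw0.trans_le ((le_abs_self _).trans (Complex.abs_im_le_norm w))
  have hne : ∀ t : ℝ, 0 < ‖(t : ℂ) - w‖ := fun t => by
    refine norm_pos_iff.2 fun h => hw0.ne' ?_
    simpa using congrArg Complex.im h
  -- A lower bound for `R / |t - w|` on the support of the law. It remains to bound the second
  -- moment by a multiple of `B ^ s`.
  set B : ℝ := R / (A + ‖w‖) with hB
  have hB0 : 0 ≤ B := by positivity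
  have lower : ENNReal.ofReal (B ^ s) ≤ ∫⁻ t, ENNReal.ofReal ((R / ‖(t : ℂ) - w‖) ^ s) ∂ν := by
    calc ENNReal.ofReal (B ^ s) = ∫⁻ _, ENNReal.ofReal (B ^ s) ∂ν := by simp
      _ ≤ _ := by
        refine lintegral_mono_ae ?_
        filter_upwards [hνA] with t ht
        have h1 := hne t
        have h2 : ‖(t : ℂ) - w‖ ≤ A + ‖w‖ :=
          (norm_sub_le _ _).trans (by rw [Complex.norm_real]; exact add_le_add_left ht _)
        have h3 : B ≤ R / ‖(t : ℂ) - w‖ := div_le_div_of_nonneg_left hR h1 h2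
        gcongr
  refine le_trans ?_ (mul_le_mul_right lower _)
  rw [← ENNReal.ofReal_mul (by positivity)]
  have hBs : 0 ≤ B ^ s := by positivity
  -- For `|w| ≤ 2A` the singularity may be close to the support: the bounded density and the Cauchy
  -- integral are used, and `R ≤ 3A B` yields the constant `3A`. For `|w| > 2A` the distance `|t -
  -- w|` is at least `|w| / 2`, which gives `4`, and `R / |w| ≤ 2B` gives `2`, hence `8`.
  rcases le_or_gt ‖w‖ (2 * A) with hcase | hcase
  · have h1 : ∫⁻ t, ENNReal.ofReal (ε * (R / ‖(t : ℂ) - w‖) ^ 2) ∂ν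
        ≤ ENNReal.ofReal (|M| * (ε * R ^ 2 * (Real.pi / w.im))) := by
      rw [hν, lintegral_withDensity_eq_lintegral_mul₀ (by fun_prop) (by fun_prop),
        ENNReal.ofReal_mul (abs_nonneg M), ← lintegral_inv_norm_sub_sq w hw0 _ (by positivity),
        ← lintegral_const_mul _ (by fun_prop)]
      refine lintegral_mono fun t => ?_
      rw [Pi.mul_apply, div_pow, mul_div_assoc]
      gcongr
      exact (hM t).trans (le_abs_self M)
    refine h1.trans (ENNReal.ofReal_le_ofReal ?_)
    have hq : ε * R ^ 2 / w.im ≤ R ^ s := by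
      refine le_rpow_of_le_one_of_le_sq hs0.le (by linarith) hR ((div_le_one hw0).2 hRw) ?_
      rw [div_le_iff₀ hw0, mul_comm]
      gcongr
    have hRs : R ^ s ≤ 3 * A * B ^ s := by
      have hR' : R ≤ 3 * A * B := by
        rw [hB, mul_div_assoc', le_div_iff₀ (by positivity), mul_comm]
        gcongr
        linarith
      calc R ^ s ≤ (3 * A * B) ^ s := by gcongr
        _ = (3 * A) ^ s * B ^ s := Real.mul_rpow (by positivity) hB0
        _ ≤ (3 * A) ^ (1 : ℝ) * B ^ s := by
          gcongr
          · linarith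
        _ = _ := by rw [Real.rpow_one]
    calc |M| * (ε * R ^ 2 * (Real.pi / w.im)) = |M| * Real.pi * (ε * R ^ 2 / w.im) := by ring
      _ ≤ |M| * Real.pi * (3 * A * B ^ s) := by
        gcongr
        exact hq.trans hRs
      _ ≤ _ := by nlinarith
  · have hw2 : 2 ≤ ‖w‖ := by linarith
    have h1 : ∫⁻ t, ENNReal.ofReal (ε * (R / ‖(t : ℂ) - w‖) ^ 2) ∂ν
        ≤ ENNReal.ofReal (4 * (ε * (R / ‖w‖) ^ 2)) := by
      calc _ ≤ ∫⁻ _, ENNReal.ofReal (4 * (ε * (R / ‖w‖) ^ 2)) ∂ν := by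
            refine lintegral_mono_ae ?_
            filter_upwards [hνA] with t ht
            refine ENNReal.ofReal_le_ofReal ?_
            have h2 : ‖w‖ / 2 ≤ ‖(t : ℂ) - w‖ := by
              have := norm_sub_norm_le w (t : ℂ)
              rw [Complex.norm_real, Real.norm_eq_abs, norm_sub_rev] at this
              linarith
            calc ε * (R / ‖(t : ℂ) - w‖) ^ 2 ≤ ε * (R / (‖w‖ / 2)) ^ 2 := by gcongr
              _ = _ := by field_simp; ring
        _ = _ := by simp
    refine h1.trans (ENNReal.ofReal_le_ofReal ?_)
    have hq : ε * (R / ‖w‖) ^ 2 ≤ (R / ‖w‖) ^ s := by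
      refine le_rpow_of_le_one_of_le_sq hs0.le (by linarith) (by positivity) ?_ ?_
      -- `ε R² ≤ Im w ≤ |w| ≤ |w|²`; the last inequality uses `|w| ≥ 1`, which is why `A ≥ 1` is
      -- required.
      · have h3 : w.im ≤ ‖w‖ := (le_abs_self _).trans (Complex.abs_im_le_norm w)
        rw [div_pow, mul_div_assoc', div_le_one (by positivity)]
        nlinarith
      · exact mul_le_of_le_one_left (by positivity) hε1
    have hBw : (R / ‖w‖) ^ s ≤ 2 * B ^ s := by
      have h4 : R / ‖w‖ ≤ 2 * B := by
        rw [hB, mul_div_assoc', div_le_div_iff₀ hwpos (by positivity)]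
        nlinarith
      calc (R / ‖w‖) ^ s ≤ (2 * B) ^ s := by gcongr
        _ = 2 ^ s * B ^ s := Real.mul_rpow (by positivity) hB0
        _ ≤ 2 ^ (1 : ℝ) * B ^ s := by
          gcongr
          · norm_num
        _ = _ := by rw [Real.rpow_one]
    have h5 : 0 ≤ |M| * Real.pi * (3 * A) * B ^ s := by positivity
    linarith

end SingleSiteAverage

/-! ### Resampling one coordinate of a product measure. -/

section Resampling

/-- The two measures agree on finite boxes: the factor at `x`, if present, is supplied by the new
coordinate, and the old one is integrated out. -/
theorem map_update_infinitePi {ι : Type*} [DecidableEq ι] {X : ι → Type*}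
    [∀ i, MeasurableSpace (X i)] (μ : (i : ι) → Measure (X i)) [∀ i, IsProbabilityMeasure (μ i)]
    (x : ι) : ((Measure.infinitePi μ).prod (μ x)).map (fun p => Function.update p.1 x p.2)
      = Measure.infinitePi μ := by
  refine Measure.eq_infinitePi μ fun s t ht => ?_
  rw [Measure.map_apply measurable_update' (MeasurableSet.pi s.countable_toSet fun i _ => ht i)]
  by_cases hx : x ∈ s
  · have : (fun p : (∀ i, X i) × X x => Function.update p.1 x p.2) ⁻¹' (Set.pi s t)
        = (Set.pi (s.erase x) t) ×ˢ t x := by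
      ext p
      simp only [Set.mem_preimage, Set.mem_pi, Set.mem_prod, Finset.coe_erase, Set.mem_sdiff,
        Set.mem_singleton_iff, Finset.mem_coe]
      constructor
      · intro h
        refine ⟨fun i hi => ?_, ?_⟩
        · simpa [hi.2] using h i hi.1
        · simpa using h x hx
      · rintro ⟨h1, h2⟩ i hi
        rcases eq_or_ne i x with rfl | hne
        · simpa using h2
        · simpa [hne] using h1 i ⟨hi, hne⟩
    rw [this, Measure.prod_prod, Measure.infinitePi_pi μ (fun i _ => ht i), mul_comm,
      Finset.mul_prod_erase s (fun i => μ i (t i)) hx]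
  · have : (fun p : (∀ i, X i) × X x => Function.update p.1 x p.2) ⁻¹' (Set.pi s t)
        = (Set.pi s t) ×ˢ Set.univ := by
      ext p
      simp only [Set.mem_preimage, Set.mem_pi, Set.mem_prod, Set.mem_univ, and_true,
        Finset.mem_coe]
      refine forall₂_congr fun i hi => ?_
      have : i ≠ x := fun h => hx (h ▸ hi)
      simp [this]
    rw [this, Measure.prod_prod, measure_univ, mul_one, Measure.infinitePi_pi μ (fun i _ => ht i)]

theorem lintegral_infinitePi_eq_lintegral_update {ι : Type*} [DecidableEq ι] {X : ι → Type*}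
    [∀ i, MeasurableSpace (X i)] (μ : (i : ι) → Measure (X i)) [∀ i, IsProbabilityMeasure (μ i)]
    (x : ι) {F : (∀ i, X i) → ℝ≥0∞} (hF : Measurable F) :
    ∫⁻ v, F v ∂(Measure.infinitePi μ)
      = ∫⁻ v, ∫⁻ t, F (Function.update v x t) ∂(μ x) ∂(Measure.infinitePi μ) := by
  conv_lhs => rw [← map_update_infinitePi μ x, lintegral_map hF measurable_update']
  exact lintegral_prod _ (hF.comp measurable_update').aemeasurable

end Resampling

/-! ### Exponential sums over the lattice. -/

section LatticeSums

variable {d : ℕ}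

theorem latticeDist_nonneg (x y : Fin d → ℤ) : 0 ≤ latticeDist x y :=
  Finset.sum_nonneg fun _ _ => abs_nonneg _

theorem latticeDist_triangle (n x y : Fin d → ℤ) :
    latticeDist x y ≤ latticeDist n x + latticeDist n y := by
  unfold latticeDist
  rw [← Finset.sum_add_distrib]
  refine Finset.sum_le_sum fun i _ => ?_
  have h := abs_sub_le (x i) (n i) (y i)
  rwa [abs_sub_comm (x i) (n i)] at h

theorem summable_exp_neg_mul_abs_int {c : ℝ} (hc : 0 < c) :
    Summable fun k : ℤ => Real.exp (-c * |(k : ℝ)|) := by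
  have h : Summable fun n : ℕ => Real.exp (-c * n) := by
    have := summable_geometric_of_lt_one (Real.exp_pos (-c)).le (by simpa using hc)
    refine this.congr fun n => ?_
    rw [← Real.exp_nat_mul, mul_comm]
  refine Summable.of_nat_of_neg ?_ ?_ <;> simpa using h

theorem tsum_exp_neg_mul_sum_abs_ne_top {c : ℝ} (hc : 0 < c) (d : ℕ) :
    ∑' k : Fin d → ℤ, ENNReal.ofReal (Real.exp (-c * ∑ i, |(k i : ℝ)|)) ≠ ⊤ := by
  induction d with
  | zero =>
    rw [tsum_eq_single (0 : Fin 0 → ℤ) fun b hb => absurd (Subsingleton.elim b 0) hb]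
    exact ENNReal.ofReal_ne_top
  | succ d ih =>
    rw [← (Fin.consEquiv fun _ : Fin (d + 1) => ℤ).tsum_eq]
    have h : ∀ p : ℤ × (Fin d → ℤ),
        ENNReal.ofReal (Real.exp (-c * ∑ i,
          |((Fin.consEquiv (fun _ : Fin (d + 1) => ℤ) p i : ℤ) : ℝ)|))
        = ENNReal.ofReal (Real.exp (-c * |(p.1 : ℝ)|))
          * ENNReal.ofReal (Real.exp (-c * ∑ i, |(p.2 i : ℝ)|)) := by
      intro p
      rw [← ENNReal.ofReal_mul (Real.exp_pos _).le, ← Real.exp_add, Fin.sum_univ_succ]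
      simp [Fin.consEquiv, mul_add]
    rw [tsum_congr h, ENNReal.tsum_prod (f := fun (a : ℤ) (b : Fin d → ℤ) =>
      ENNReal.ofReal (Real.exp (-c * |(a : ℝ)|))
        * ENNReal.ofReal (Real.exp (-c * ∑ i, |(b i : ℝ)|)))]
    simp only [ENNReal.tsum_mul_left, ENNReal.tsum_mul_right]
    exact ENNReal.mul_ne_top (summable_exp_neg_mul_abs_int hc).tsum_ofReal_ne_top ih

theorem tsum_exp_neg_mul_latticeDist (c : ℝ) (x : Fin d → ℤ) :
    ∑' n : Fin d → ℤ, ENNReal.ofReal (Real.exp (-c * latticeDist n x))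
      = ∑' k : Fin d → ℤ, ENNReal.ofReal (Real.exp (-c * ∑ i, |(k i : ℝ)|)) := by
  rw [← (Equiv.subRight x).tsum_eq fun k : Fin d → ℤ =>
    ENNReal.ofReal (Real.exp (-c * ∑ i, |(k i : ℝ)|))]
  refine tsum_congr fun n => ?_
  simp [latticeDist]

end LatticeSums

/-! ### Second moments of the Green function. -/

section SecondMoment

variable {d : ℕ}

/-- The potential obtained by truncating all values to `[-A, A]`. -/
def clampPotential (A : ℝ) (v : (Fin d → ℤ) → ℝ) (n : Fin d → ℤ) : ℝ := max (-A) (min A (v n))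

theorem abs_clampPotential_le {A : ℝ} (hA : 0 ≤ A) (v : (Fin d → ℤ) → ℝ) (n : Fin d → ℤ) :
    |clampPotential A v n| ≤ A :=
  abs_le.2 ⟨le_max_left _ _, max_le (by linarith) (min_le_left _ _)⟩

theorem clampPotential_eq_self {A : ℝ} {v : (Fin d → ℤ) → ℝ} (hv : ∀ n, |v n| ≤ A) :
    clampPotential A v = v := by
  ext n
  rw [clampPotential, min_eq_right (abs_le.1 (hv n)).2, max_eq_right (abs_le.1 (hv n)).1]

theorem clampPotential_update {A : ℝ} (v : (Fin d → ℤ) → ℝ) (x : Fin d → ℤ) {t : ℝ}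
    (ht : |t| ≤ A) : clampPotential A (Function.update v x t)
      = Function.update (clampPotential A v) x t := by
  ext n
  rcases eq_or_ne n x with rfl | hn
  · simp [clampPotential, min_eq_right (abs_le.1 ht).2, max_eq_right (abs_le.1 ht).1]
  · simp [clampPotential, hn]

theorem measurable_clampPotential (A : ℝ) (n : Fin d → ℤ) :
    Measurable fun v : (Fin d → ℤ) → ℝ => clampPotential A v n := by
  unfold clampPotential
  fun_prop

/-- The second moment of the Green function is bounded by its fractional moments. -/
theorem lintegral_greenFunction_sq_le {ρ : ℝ → ℝ} (hρ : Measurable ρ) {M : ℝ} (hM : ∀ v, ρ v ≤ M)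
    (ν : Measure ℝ) [IsProbabilityMeasure ν]
    (hν : ν = volume.withDensity fun v => ENNReal.ofReal (ρ v)) {A : ℝ} (hA : 1 ≤ A)
    (hνA : ∀ᵐ t ∂ν, |t| ≤ A) {s : ℝ} (hs : s ∈ Set.Ioo (0 : ℝ) 1) {ε : ℝ} (hε : 0 < ε) (hε1 : ε ≤ 1)
    (n x : Fin d → ℤ) (E : ℝ) :
    ∫⁻ v, ENNReal.ofReal ε * ‖greenFunction (clampPotential A v) n x (E + ε * Complex.I)‖ₑ ^ 2
        ∂(Measure.infinitePi fun _ : Fin d → ℤ => ν)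
      ≤ ENNReal.ofReal (|M| * Real.pi * (3 * A) + 8)
        * ∫⁻ v, ‖greenFunction (clampPotential A v) n x (E + ε * Complex.I)‖ₑ ^ s
          ∂(Measure.infinitePi fun _ : Fin d → ℤ => ν) := by
  have hA0 : 0 ≤ A := zero_le_one.trans hA
  have hG : Measurable fun v : (Fin d → ℤ) → ℝ =>
      ‖greenFunction (clampPotential A v) n x (E + ε * Complex.I)‖ₑ :=
    (measurable_greenFunction hA0 (measurable_clampPotential A)
      (fun v => abs_clampPotential_le hA0 v) n x (im_add_mul_I_ne_zero hε E)).enorm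
  -- Both sides are averaged first over the value at `x`, the other sites being frozen. The
  -- single-site inequality holds for each frozen configuration with the same constant.
  rw [lintegral_infinitePi_eq_lintegral_update _ x ((hG.pow_const 2).const_mul _),
    lintegral_infinitePi_eq_lintegral_update _ x (hG.pow_const s),
    ← lintegral_const_mul' _ _ ENNReal.ofReal_ne_top]
  refine lintegral_mono fun v => ?_
  obtain ⟨w, R, hR, h1, h2, h3⟩ := exists_greenFunction_update hA0 (abs_clampPotential_le hA0 v)
    n x (z := E + ε * Complex.I) (by simpa using hε)
  have him : (E + ε * Complex.I : ℂ).im = ε := by simp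
  rw [him] at h1 h2
  have key := lintegral_sq_le_lintegral_rpow hρ hM ν hν hA hνA hs hε hε1 hR h1 h2
  refine le_trans (le_of_eq ?_) (key.trans (le_of_eq ?_))
  · refine lintegral_congr_ae ?_
    filter_upwards [hνA] with t ht
    rw [clampPotential_update v x ht, ← ofReal_norm, h3 t ht, ENNReal.ofReal_mul hε.le,
      ENNReal.ofReal_pow (by positivity)]
  · congr 1
    refine lintegral_congr_ae ?_
    filter_upwards [hνA] with t ht
    rw [clampPotential_update v x ht, ← ofReal_norm, h3 t ht,
      ENNReal.ofReal_rpow_of_nonneg (by positivity) hs.1.le]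

theorem lintegral_mul_le_of_lintegral_sq_le {α : Type*} [MeasurableSpace α] {μ : Measure α}
    {f g : α → ℝ≥0∞} (hf : AEMeasurable f μ) (hg : AEMeasurable g μ) {X Y : ℝ} (hX : 0 ≤ X)
    (hY : 0 ≤ Y) (hfX : ∫⁻ o, f o ^ 2 ∂μ ≤ ENNReal.ofReal X)
    (hgY : ∫⁻ o, g o ^ 2 ∂μ ≤ ENNReal.ofReal Y) :
    ∫⁻ o, f o * g o ∂μ ≤ ENNReal.ofReal (√X * √Y) := by
  have h := ENNReal.lintegral_mul_le_Lp_mul_Lq μ Real.HolderConjugate.two_two hf hg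
  simp only [ENNReal.rpow_two, Pi.mul_apply] at h
  refine h.trans ?_
  rw [ENNReal.ofReal_mul (Real.sqrt_nonneg X), Real.sqrt_eq_rpow, Real.sqrt_eq_rpow,
    ← ENNReal.ofReal_rpow_of_nonneg hX (by norm_num),
    ← ENNReal.ofReal_rpow_of_nonneg hY (by norm_num)]
  gcongr

end SecondMoment

/-! ### Exponential decay of the eigenfunction correlator. -/

section EigenfunctionCorrelator

variable {d : ℕ}

theorem enorm_inner_inverse_le_tsum (v : (Fin d → ℤ) → ℝ) (x y : Fin d → ℤ) (z : ℂ) {ε : ℝ}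
    (hε : 0 ≤ ε) :
    ‖(ε : ℂ) * inner ℂ
        (Ring.inverse (andersonHamiltonian v - z • ContinuousLinearMap.id ℂ (LatticeL2 d))
          (basisVector x))
        (Ring.inverse (andersonHamiltonian v - z • ContinuousLinearMap.id ℂ (LatticeL2 d))
          (basisVector y))‖ₑ
      ≤ ∑' n, (ENNReal.ofReal √ε * ‖greenFunction v n x z‖ₑ)
        * (ENNReal.ofReal √ε * ‖greenFunction v n y z‖ₑ) := by
  rw [lp.inner_eq_tsum, enorm_mul]
  have hεn : ‖(ε : ℂ)‖ₑ = ENNReal.ofReal √ε * ENNReal.ofReal √ε := by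
    rw [← ENNReal.ofReal_mul (Real.sqrt_nonneg _), Real.mul_self_sqrt hε, ← ofReal_norm,
      Complex.norm_real, Real.norm_of_nonneg hε]
  refine (mul_le_mul_right enorm_tsum_le_tsum_enorm _).trans (le_of_eq ?_)
  rw [← ENNReal.tsum_mul_left]
  refine tsum_congr fun n => ?_
  rw [hεn, greenFunction, greenFunction, inner_basisVector_left, inner_basisVector_left,
    RCLike.inner_apply, enorm_mul, RCLike.enorm_conj]
  ring

/-- The eigenfunction correlator is controlled by products of Green functions. -/
theorem borelSupremum_le_liminf (v : (Fin d → ℤ) → ℝ) (a b : ℝ) (x y : Fin d → ℤ) {ε : ℕ → ℝ}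
    (hε : ∀ k, 0 < ε k) (hε0 : Tendsto ε atTop (𝓝 0)) :
    borelSupremum v (Set.Ioo a b) x y ≤ liminf (fun k => ∫⁻ E in Set.Ioo a b,
      ∑' n, (ENNReal.ofReal √(ε k) * ‖greenFunction v n x (E + ε k * Complex.I)‖ₑ)
        * (ENNReal.ofReal √(ε k) * ‖greenFunction v n y (E + ε k * Complex.I)‖ₑ)) atTop := by
  have hsa := isSelfAdjoint_andersonHamiltonian v
  have hχ : Measurable ((Set.Ioo a b).indicator (1 : ℝ → ℂ)) :=
    measurable_one.indicator measurableSet_Ioo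
  refine iSup_le fun g => ?_
  rw [borelCalculus_mul_spectralProjection _ hsa g.2.1 g.2.2 measurableSet_Ioo]
  obtain ⟨f, h1, h2, h3⟩ := exists_continuous_seq_tendsto_ae_spectralMeasure
    (andersonHamiltonian v) (polarization (basisVector x) (basisVector y)).support g.2.1 g.2.2
  -- The cutoff makes the approximants both continuous and zero outside the interval, as the liminf
  -- bound demands. That bound is the same for every `j`, so it survives the limit.
  have hc : ∀ j, Continuous fun r => f j r * intervalCutoff a b j r := fun j =>
    (h1 j).mul (Complex.continuous_ofReal.comp (continuous_intervalCutoff a b j))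
  have t := tendsto_inner_borelCalculus (andersonHamiltonian v)
    (F := fun j r => f j r * intervalCutoff a b j r)
    (fun j => (hc j).measurable) (g.2.1.mul hχ)
    (fun j => norm_mul_intervalCutoff_le (h2 j) a b j) (norm_mul_indicator_le g.2.2 _)
    (basisVector x) (basisVector y) fun v hv => by
      filter_upwards [h3 v hv] with r hr using hr.mul (tendsto_intervalCutoff a b r)
  refine le_of_tendsto ((continuous_enorm.tendsto _).comp t) (Eventually.of_forall fun j => ?_)
  refine (enorm_inner_borelCalculus_le_liminf _ hsa (hc j)
    (norm_mul_intervalCutoff_le (h2 j) a b j)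
    (a := a) (b := b) (fun r hr => by simp [intervalCutoff_eq_zero hr]) hε hε0 _ _).trans ?_
  exact liminf_le_liminf (Eventually.of_forall fun k => lintegral_mono fun E =>
    enorm_inner_inverse_le_tsum v x y _ (hε k).le)

/-- The exponent `(m/2)(p + q)` is split in halves: one gives decay in `r ≤ p + q`, the other keeps
`p` so that the sum over the lattice converges. This is the origin of the rate `m / 4`. -/
theorem sqrt_mul_exp_mul_sqrt_mul_exp_le {D m p q r : ℝ} (hD : 0 ≤ D) (hm : 0 < m)
    (hq : 0 ≤ q) (hr : r ≤ p + q) :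
    √(D * Real.exp (-m * p)) * √(D * Real.exp (-m * q))
      ≤ D * Real.exp (-(m / 4) * r) * Real.exp (-(m / 4) * p) := by
  have hsq : ∀ t : ℝ, √(D * Real.exp t) = √D * Real.exp (t / 2) := fun t => by
    rw [Real.sqrt_mul hD, Real.exp_half]
  rw [hsq, hsq, mul_mul_mul_comm, Real.mul_self_sqrt hD, ← Real.exp_add, mul_assoc,
    ← Real.exp_add]
  refine mul_le_mul_of_nonneg_left (Real.exp_le_exp.2 ?_) hD
  nlinarith [mul_nonneg hm.le hq, mul_le_mul_of_nonneg_left hr hm.le]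

/-- Products of random functions on the lattice whose second moments decay exponentially. -/
theorem lintegral_tsum_mul_le {α : Type*} [MeasurableSpace α] (L : Measure α)
    {f g : (Fin d → ℤ) → α → ℝ≥0∞} (hf : ∀ n, Measurable (f n)) (hg : ∀ n, Measurable (g n))
    {D m : ℝ} (hD : 0 ≤ D) (hm : 0 < m) (x y : Fin d → ℤ)
    (hfD : ∀ n, ∫⁻ o, f n o ^ 2 ∂L ≤ ENNReal.ofReal (D * Real.exp (-m * latticeDist n x)))
    (hgD : ∀ n, ∫⁻ o, g n o ^ 2 ∂L ≤ ENNReal.ofReal (D * Real.exp (-m * latticeDist n y))) :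
    ∫⁻ o, ∑' n, f n o * g n o ∂L
      ≤ ENNReal.ofReal (D * Real.exp (-(m / 4) * latticeDist x y))
        * ∑' k : Fin d → ℤ, ENNReal.ofReal (Real.exp (-(m / 4) * ∑ i, |(k i : ℝ)|)) := by
  rw [lintegral_tsum (f := fun n o => f n o * g n o) fun n => ((hf n).mul (hg n)).aemeasurable,
    ← tsum_exp_neg_mul_latticeDist (m / 4) x, ← ENNReal.tsum_mul_left]
  refine ENNReal.tsum_le_tsum fun n => ?_
  rw [← ENNReal.ofReal_mul (by positivity)]
  refine (lintegral_mul_le_of_lintegral_sq_le (hf n).aemeasurable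
    (hg n).aemeasurable (by positivity) (by positivity) (hfD n) (hgD n)).trans
    (ENNReal.ofReal_le_ofReal (sqrt_mul_exp_mul_sqrt_mul_exp_le hD hm ?_ ?_))
  · exact_mod_cast latticeDist_nonneg n y
  · exact_mod_cast latticeDist_triangle n x y

/-- Exponential decay of second moments of the Green function implies exponential decay of the
eigenfunction correlator. -/
theorem lintegral_borelSupremum_le {α : Type*} [MeasurableSpace α] (L : Measure α) [SFinite L]
    {w : α → (Fin d → ℤ) → ℝ} {A : ℝ} (hA : 0 ≤ A) (hw : ∀ n, Measurable fun o => w o n)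
    (hwA : ∀ o n, |w o n| ≤ A) (a b : ℝ) {D m : ℝ} (hD : 0 ≤ D) (hm : 0 < m)
    (hG : ∀ x y : Fin d → ℤ, ∀ E ∈ Set.Ioo a b, ∀ ε : ℝ, 0 < ε → ε ≤ 1 →
      ∫⁻ o, ENNReal.ofReal ε * ‖greenFunction (w o) x y (E + ε * Complex.I)‖ₑ ^ 2 ∂L
        ≤ ENNReal.ofReal (D * Real.exp (-m * latticeDist x y))) :
    ∃ C : ℝ, ∀ x y : Fin d → ℤ, ∫⁻ o, borelSupremum (w o) (Set.Ioo a b) x y ∂L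
      ≤ ENNReal.ofReal (C * Real.exp (-(m / 4) * latticeDist x y)) := by
  have hStop := tsum_exp_neg_mul_sum_abs_ne_top (c := m / 4) (by positivity) d
  generalize hS : ∑' k : Fin d → ℤ, ENNReal.ofReal (Real.exp (-(m / 4) * ∑ i, |(k i : ℝ)|)) = S
    at hStop
  -- The product of the second-moment constant, the lattice sum and the length of the interval; the
  -- maximum covers an empty interval.
  refine ⟨D * S.toReal * (max (b - a) 0), fun x y => ?_⟩
  obtain ⟨ε, hε, hε1, hε0⟩ : ∃ ε : ℕ → ℝ, (∀ k, 0 < ε k) ∧ (∀ k, ε k ≤ 1) ∧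
      Tendsto ε atTop (𝓝 0) := by
    refine ⟨fun k => 1 / ((k : ℝ) + 1), fun k => by positivity, fun k => ?_,
      tendsto_one_div_add_atTop_nhds_zero_nat⟩
    have : (0 : ℝ) ≤ k := by positivity
    exact (div_le_one (by positivity)).2 (by linarith)
  -- Each Green function carries half of the weight `ε`, so that Cauchy–Schwarz produces exactly the
  -- quantity `ε |G|²` that is controlled.
  obtain ⟨Γ, hΓ⟩ : ∃ Γ : ℕ → (Fin d → ℤ) → (Fin d → ℤ) → ℝ → α → ℝ≥0∞, ∀ k n u E o, Γ k n u E o =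
      ENNReal.ofReal √(ε k) * ‖greenFunction (w o) n u (E + ε k * Complex.I)‖ₑ :=
    ⟨_, fun _ _ _ _ _ => rfl⟩
  have hΓm : ∀ k n u, Measurable (Function.uncurry (Γ k n u)) := fun k n u => by
    have : Γ k n u = fun (E : ℝ) o =>
        ENNReal.ofReal √(ε k) * ‖greenFunction (w o) n u (E + ε k * Complex.I)‖ₑ := by
      ext E o
      exact hΓ k n u E o
    rw [this]
    exact (measurable_uncurry_greenFunction hA hw hwA n u (hε k)).enorm.const_mul _
  have hΓo : ∀ k n u E, Measurable (Γ k n u E) := fun k n u E =>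
    (hΓm k n u).comp measurable_prodMk_left
  have hΓsq : ∀ k n u, ∀ E ∈ Set.Ioo a b, ∫⁻ o, Γ k n u E o ^ 2 ∂L
      ≤ ENNReal.ofReal (D * Real.exp (-m * latticeDist n u)) := fun k n u E hE => by
    refine le_trans (le_of_eq (lintegral_congr fun o => ?_)) (hG n u E hE (ε k) (hε k) (hε1 k))
    rw [hΓ, mul_pow, ← ENNReal.ofReal_pow (Real.sqrt_nonneg _), Real.sq_sqrt (hε k).le]
  have hsumm : ∀ k, Measurable (Function.uncurry fun (E : ℝ) o =>
      ∑' n, Γ k n x E o * Γ k n y E o) := fun k =>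
    Measurable.tsum fun n => (hΓm k n x).mul (hΓm k n y)
  have hbound : ∀ k, ∫⁻ o, (∫⁻ E in Set.Ioo a b, ∑' n, Γ k n x E o * Γ k n y E o) ∂L
      ≤ ENNReal.ofReal (D * S.toReal * (max (b - a) 0)
        * Real.exp (-(m / 4) * latticeDist x y)) := by
    intro k
    rw [lintegral_lintegral_swap (f := fun o E => ∑' n, Γ k n x E o * Γ k n y E o)
      ((hsumm k).comp measurable_swap).aemeasurable]
    calc _ ≤ ∫⁻ E in Set.Ioo a b,
          ENNReal.ofReal (D * Real.exp (-(m / 4) * latticeDist x y)) * S := by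
          refine setLIntegral_mono measurable_const fun E hE => ?_
          rw [← hS]
          exact lintegral_tsum_mul_le L (fun n => hΓo k n x E) (fun n => hΓo k n y E) hD hm x y
            (fun n => hΓsq k n x E hE) (fun n => hΓsq k n y E hE)
      _ = ENNReal.ofReal (D * Real.exp (-(m / 4) * latticeDist x y))
            * ENNReal.ofReal S.toReal * ENNReal.ofReal (max (b - a) 0) := by
          rw [setLIntegral_const, Real.volume_Ioo, ENNReal.ofReal_toReal hStop]
          congr 1
          rcases le_total (b - a) 0 with h | h
          · simp [max_eq_right h, ENNReal.ofReal_of_nonpos h]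
          · rw [max_eq_left h]
      _ = _ := by
          rw [← ENNReal.ofReal_mul (by positivity), ← ENNReal.ofReal_mul (by positivity)]
          congr 1
          ring
  -- The supremum is already absorbed inside the expectation, so Fatou is the only limit theorem
  -- needed here.
  calc ∫⁻ o, borelSupremum (w o) (Set.Ioo a b) x y ∂L
      ≤ ∫⁻ o, liminf (fun k => ∫⁻ E in Set.Ioo a b, ∑' n, Γ k n x E o * Γ k n y E o) atTop ∂L := by
        simp only [hΓ]
        exact lintegral_mono fun o => borelSupremum_le_liminf (w o) a b x y hε hε0
    _ ≤ liminf (fun k => ∫⁻ o, (∫⁻ E in Set.Ioo a b, ∑' n, Γ k n x E o * Γ k n y E o) ∂L) atTop :=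
        lintegral_liminf_le fun k => (hsumm k).lintegral_prod_left
    _ ≤ liminf (fun _ : ℕ => ENNReal.ofReal (D * S.toReal * (max (b - a) 0)
        * Real.exp (-(m / 4) * latticeDist x y))) atTop :=
        liminf_le_liminf (Eventually.of_forall hbound)
    _ = _ := liminf_const _

end EigenfunctionCorrelator

end

/-! ### Localization from fractional moments. -/

theorem theorem5p1 {d : ℕ} {Ω : Type*} [MeasurableSpace Ω] (P : Measure Ω) [IsProbabilityMeasure P]
    (ω : (Fin d → ℤ) → Ω → ℝ) (hω_meas : ∀ n, Measurable (ω n)) (hω_indep : iIndepFun ω P)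
    (ρ : ℝ → ℝ) (hρ_meas : Measurable ρ) (hρ_nonneg : ∀ v, 0 ≤ ρ v)
    (hρ_bdd : ∃ M, ∀ v, ρ v ≤ M) (hρ_supp : HasCompactSupport ρ)
    (hω_law : ∀ n, P.map (ω n) = volume.withDensity fun v => ENNReal.ofReal (ρ v))
    (a b : ℝ) (s : ℝ) (hs : s ∈ Set.Ioo (0 : ℝ) 1) (C m : ℝ) (hm : 0 < m)
    (hG : ∀ x y : Fin d → ℤ, ∀ E ∈ Set.Ioo a b, ∀ ε : ℝ, 0 < ε →
      ∫⁻ o, ‖greenFunction (fun n => ω n o) x y (E + ε * Complex.I)‖ₑ ^ s ∂P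
        ≤ ENNReal.ofReal (C * Real.exp (-m * latticeDist x y))) :
    DynamicalLocalization P ω (Set.Ioo a b) ∧
    (ExponentialDecay P fun x y o => spectralVariation (fun n => ω n o) (Set.Ioo a b) x y) ∧
    (∀ x y : Fin d → ℤ, AEMeasurable (fun o => borelSupremum (fun n => ω n o) (Set.Ioo a b) x y) P ∧
      ∫⁻ o, spectralVariation (fun n => ω n o) (Set.Ioo a b) x y ∂P
        = ∫⁻ o, borelSupremum (fun n => ω n o) (Set.Ioo a b) x y ∂P) := by
  obtain ⟨M, hM⟩ := hρ_bdd
  obtain ⟨A₀, hA₀⟩ := hρ_supp.isCompact.isBounded.exists_norm_le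
  let A : ℝ := max 1 A₀
  have hA1 : 1 ≤ A := le_max_left _ _
  have hA : 0 ≤ A := zero_le_one.trans hA1
  set ν : Measure ℝ := volume.withDensity fun v => ENNReal.ofReal (ρ v) with hν
  have hνp : IsProbabilityMeasure ν := by
    rw [← hω_law 0]
    exact Measure.isProbabilityMeasure_map (hω_meas 0).aemeasurable
  have hνA : ∀ᵐ t ∂ν, |t| ≤ A := by
    rw [hν, ae_withDensity_iff (by fun_prop)]
    refine Filter.Eventually.of_forall fun t ht => ?_
    have : t ∈ tsupport ρ := subset_tsupport ρ fun h => ht (by simp [h])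
    exact (hA₀ t this).trans (le_max_right _ _)
  have hωA : ∀ᵐ o ∂P, ∀ n, |ω n o| ≤ A := by
    rw [ae_all_iff]
    intro n
    rw [← hω_law n] at hνA
    exact ae_of_ae_map (hω_meas n).aemeasurable hνA
  have hmap : P.map (fun o n => ω n o) = Measure.infinitePi fun _ : Fin d → ℤ => ν := by
    rw [hω_indep.map_fun_eq_infinitePi_map hω_meas]
    simp only [hω_law]
  -- The potential is bounded only almost surely. Its truncation is bounded everywhere and almost
  -- surely equal to it, so measurability proved for the truncation becomes almost everywhere
  -- measurability for `ω`.
  let w : Ω → (Fin d → ℤ) → ℝ := fun o => clampPotential A fun n => ω n o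
  have hw : ∀ n, Measurable fun o => w o n := fun n =>
    (measurable_clampPotential A n).comp (measurable_pi_lambda _ hω_meas)
  have hwA : ∀ o n, |w o n| ≤ A := fun o => abs_clampPotential_le hA _
  have hwω : ∀ᵐ o ∂P, w o = fun n => ω n o := by
    filter_upwards [hωA] with o ho using clampPotential_eq_self ho
  have hae : ∀ F : ((Fin d → ℤ) → ℝ) → ℝ≥0∞,
      (fun o => F (w o)) =ᵐ[P] fun o => F fun n => ω n o := fun F => by
    filter_upwards [hwω] with o ho using by rw [ho]
  set K : ℝ := |M| * Real.pi * (3 * A) + 8 with hK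
  have hK0 : 0 ≤ K := by positivity
  -- Independence makes the joint law an infinite product, so one site can be averaged alone. The
  -- constant uses `|C|` because it must be nonnegative in what follows.
  have hG2 : ∀ x y : Fin d → ℤ, ∀ E ∈ Set.Ioo a b, ∀ ε : ℝ, 0 < ε → ε ≤ 1 →
      ∫⁻ o, ENNReal.ofReal ε * ‖greenFunction (w o) x y (E + ε * Complex.I)‖ₑ ^ 2 ∂P
        ≤ ENNReal.ofReal (K * |C| * Real.exp (-m * latticeDist x y)) := by
    intro x y E hE ε hε hε1
    have hmeas : Measurable fun v : (Fin d → ℤ) → ℝ =>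
        ‖greenFunction (clampPotential A v) x y (E + ε * Complex.I)‖ₑ :=
      (measurable_greenFunction hA (measurable_clampPotential A)
        (fun v => abs_clampPotential_le hA v) x y (im_add_mul_I_ne_zero hε E)).enorm
    have h := lintegral_greenFunction_sq_le hρ_meas hM ν hν hA1 hνA hs hε hε1 x y E
    rw [← hmap, lintegral_map ((hmeas.pow_const 2).const_mul _) (measurable_pi_lambda _ hω_meas),
      lintegral_map (hmeas.pow_const s) (measurable_pi_lambda _ hω_meas)] at h
    refine h.trans ?_
    rw [mul_assoc K, ENNReal.ofReal_mul hK0]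
    refine mul_le_mul_right ?_ _
    rw [lintegral_congr_ae (hae fun v => ‖greenFunction v x y (E + ε * Complex.I)‖ₑ ^ s)]
    refine (hG x y E hE ε hε).trans (ENNReal.ofReal_le_ofReal ?_)
    gcongr
    exact le_abs_self C
  obtain ⟨C', hC'⟩ := lintegral_borelSupremum_le P hA hw hwA a b (by positivity) hm hG2
  have hbs : ∀ x y : Fin d → ℤ,
      AEMeasurable (fun o => borelSupremum (fun n => ω n o) (Set.Ioo a b) x y) P := fun x y =>
    (measurable_borelSupremum hA hw hwA a b x y).aemeasurable.congr
      (hae fun v => borelSupremum v (Set.Ioo a b) x y)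
  have hle : ∀ x y : Fin d → ℤ, ∫⁻ o, borelSupremum (fun n => ω n o) (Set.Ioo a b) x y ∂P
      ≤ ENNReal.ofReal (C' * Real.exp (-(m / 4) * latticeDist x y)) := fun x y => by
    rw [← lintegral_congr_ae (hae fun v => borelSupremum v (Set.Ioo a b) x y)]
    exact hC' x y
  refine ⟨⟨C', m / 4, by positivity, fun x y => ⟨?_, ?_⟩⟩,
    ⟨C', m / 4, by positivity, fun x y => ?_⟩, fun x y => ⟨hbs x y, ?_⟩⟩
  · exact (measurable_timeSupremum hA hw hwA a b x y).aemeasurable.congr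
      (hae fun v => timeSupremum v (Set.Ioo a b) x y)
  · exact (lintegral_mono fun o => timeSupremum_le_borelSupremum _ _ x y).trans (hle x y)
  · simp only [spectralVariation_eq_borelSupremum _ measurableSet_Ioo]
    exact ⟨hbs x y, hle x y⟩
  · simp only [spectralVariation_eq_borelSupremum _ measurableSet_Ioo]
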